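/- Let $m\ge 6$ be even, write $m=2t+2$, and let $R=\mathrm{RM}(m-3,m)$ be the binary Reed–Muller code of length $2^m$ (the evaluations on $\mathbb F_2^m$ of all polynomials in $m$ variables over $\mathbb F_2$ of degree at most $m-3$). **Goethals code.** Let $F$ be the field with $2^{m-1}$ elements and identify $\mathbb F_2^m$ with $F\times\mathbb F_2$ by an additive isomorphism, so that a binary word of length $2^m$ is a pair $(X,Y)$ of subsets of $F$ (the supports of the word on $F\times\{0\}$ and on $F\times\{1\}$). With $r=2^{t-1}+1$ and $s=2^t+1$, the Goethals code $\mathcal G(m)$ is the set of all $(X,Y)$ such that $|X|$ and $|Y|$ are even, $\sum_{x\in X}x=\sum_{y\in Y}y$, and, for $j\in\{r,s\}$, $$\sum_{x\in X}x^{j}+\Big(\sum_{x\in X}x\Big)^{j}=\sum_{y\in Y}y^{j}.$$ **Quantum codes.** For $a,b\in\mathbb F_2^n$ let $(a|b)$ denote the Pauli operator $\bigotimes_i\sigma_x^{a_i}\sigma_z^{b_i}$ on $(\mathbb C^2)^{\otimes n}$; its weight is the number of $i$ with $(a_i,b_i)\ne(0,0)$. A code $((n,K,d))$ is a $K$-dimensional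 subspace $Q\subseteq(\mathbb C^2)^{\otimes n}$ such that $d$ is the least weight of a Pauli operator $E$ for which there is no $c\in\mathbb C$ with $\langle\varphi|E|\psi\rangle=c\langle\varphi|\psi\rangle$ for all $\varphi,\psi\in Q$. A stabilizer (additive) code is the joint $+1$ eigenspace of an Abelian subgroup of the Pauli group $\{i^k(a|b)\}$ that contains no multiple of the identity other than the identity; it is denoted $[[n,k,d]]$ if it is an $((n,2^k,d))$ code. Then: 1. $R^\perp\subseteq R$, and the CSS code $\mathcal C_0$ of $R$, i.e. the joint $+1$ eigenspace of the operators $(a|0)$ and $(0|b)$ with $a,b\in R^\perp$, is a stabilizer code $[[2^m,\,2^m-2\binom m2-2m-2,\,8]]$. 2. $\mathcal G(m)$ is a union of cosets of $R$, and the number of these cosets is $K_G=2^{\binom m2-2m+2}$. 3. Let $T_1,T_2$ be any two sets of representatives of the cosets of $R$ in $\mathcal G(m)$. The translates $(t_1|t_2)\,\mathcal C_0$ with $t_1\in T_1$, $t_2\in T_2$ are pairwise orthogonal, and their direct sum (the CSS-like union code) is a quantum code $((2^m,\,2^{2^m-6m+2},\,8))$ which is non-additive, i.e. not a stabilizer code.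 For $m=6$ and $m=8$ it has the parameters $((64,2^{30},8))$ and $((256,2^{210},8))$. -/

import Mathlib

noncomputable section

namespace QCode

/-! ### Classical binary codes. Words of length `n` are functions `ι → ZMod 2`, `|ι| = n`. -/

/-- The dual of a linear binary code, for the standard inner product. -/
def dual {ι : Type*} [Fintype ι] (C : Submodule (ZMod 2) (ι → ZMod 2)) :
    Submodule (ZMod 2) (ι → ZMod 2) where
  carrier := {v | ∀ c ∈ C, v ⬝ᵥ c = 0}
  zero_mem' := by intro c _; simp
  add_mem' := by
    intro v w hv hw c hc
    rw [add_dotProduct, hv c hc, hw c hc, add_zero]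
  smul_mem' := by
    intro a v hv c hc
    rw [smul_dotProduct, hv c hc, smul_zero]

/-- The Reed-Muller code `RM(r, m)` of length `2 ^ m`: all evaluations on `𝔽₂ᵐ` of polynomials in
`m` variables of total degree at most `r`. -/
def reedMuller (r m : ℕ) : Submodule (ZMod 2) ((Fin m → ZMod 2) → ZMod 2) :=
  (MvPolynomial.restrictTotalDegree (Fin m) (ZMod 2) r).map
    (MvPolynomial.evalₗ (ZMod 2) (Fin m))

/-- For a word `c` whose coordinates are labelled by `F × 𝔽₂`, the set of those `x` in `F` for
which `c` has a one in position `(x, ε)`. -/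
def half {m : ℕ} {F : Type*} [Field F] [Fintype F]
    (e : (Fin m → ZMod 2) ≃+ F × ZMod 2) (c : (Fin m → ZMod 2) → ZMod 2) (ε : ZMod 2) :
    Finset F :=
  Finset.univ.filter fun x => c (e.symm (x, ε)) = 1

/-- The Goethals code of length `2 ^ m`, `m` even. Here `F` is the field with `2 ^ (m - 1)`
elements, and the coordinates are labelled by `F × 𝔽₂`, identified with `𝔽₂ᵐ` through `e`. A word
is a pair `(X, Y)` of subsets of `F`. With `m = 2 t + 2`, `r = 2 ^ (t - 1) + 1` and
`s = 2 ^ t + 1`, the pair is a codeword if `|X|` and `|Y|` are even, `∑ x = ∑ y`,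
`∑ x ^ r + (∑ x) ^ r = ∑ y ^ r` and `∑ x ^ s + (∑ x) ^ s = ∑ y ^ s`. -/
def goethals {m : ℕ} {F : Type*} [Field F] [Fintype F]
    (e : (Fin m → ZMod 2) ≃+ F × ZMod 2) : Set ((Fin m → ZMod 2) → ZMod 2) :=
  let r := 2 ^ (m / 2 - 2) + 1
  let s := 2 ^ (m / 2 - 1) + 1
  {c | Even (half e c 0).card ∧ Even (half e c 1).card ∧
    ∑ x ∈ half e c 0, x = ∑ y ∈ half e c 1, y ∧
    ∑ x ∈ half e c 0, x ^ r + (∑ x ∈ half e c 0, x) ^ r = ∑ y ∈ half e c 1, y ^ r ∧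
    ∑ x ∈ half e c 0, x ^ s + (∑ x ∈ half e c 0, x) ^ s = ∑ y ∈ half e c 1, y ^ s}

/-- `G` is the union of the cosets `R + t`, `t ∈ T`, and these cosets are pairwise distinct. -/
def IsCosetDecomposition {ι : Type*} (R : Submodule (ZMod 2) (ι → ZMod 2))
    (G : Set (ι → ZMod 2)) (T : Finset (ι → ZMod 2)) : Prop :=
  (G = ⋃ t ∈ T, {v | ∃ c ∈ R, v = c + t}) ∧ ∀ t ∈ T, ∀ t' ∈ T, t - t' ∈ R → t = t'

/-! ### Qubits, Pauli operators, stabilizer codes -/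

variable {ι : Type*} [Fintype ι] [DecidableEq ι]

/-- The state space `(ℂ²)^{⊗n}` of the qubits labelled by `ι`, with the computational basis
labelled by the binary words. -/
abbrev Qubits (ι : Type*) [Fintype ι] : Type _ := EuclideanSpace ℂ (ι → ZMod 2)

def sigmaX : Matrix (ZMod 2) (ZMod 2) ℂ := Matrix.of fun x y => if x = y + 1 then 1 else 0

def sigmaZ : Matrix (ZMod 2) (ZMod 2) ℂ := Matrix.diagonal fun x => if x = 0 then 1 else -1

/-- The tensor product over `i` of `σ_x ^ a_i σ_z ^ b_i`, denoted by the binary vector `(a|b)`. -/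
def pauli (a b : ι → ZMod 2) : Matrix (ι → ZMod 2) (ι → ZMod 2) ℂ :=
  Matrix.of fun x y => ∏ i, (sigmaX ^ (a i).val * sigmaZ ^ (b i).val) (x i) (y i)

/-- The operator on the state space given by `pauli a b`. -/
def pauliOp (a b : ι → ZMod 2) : Qubits ι →ₗ[ℂ] Qubits ι :=
  Matrix.toEuclideanLin (pauli a b)

/-- The number of tensor factors different from the identity. -/
def pauliWeight (a b : ι → ZMod 2) : ℕ :=
  (Finset.univ.filter fun i => a i ≠ 0 ∨ b i ≠ 0).card

/-- Membership in the Pauli group: `i ^ k` times a tensor product of Pauli matrices. -/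
def IsPauli (g : Matrix (ι → ZMod 2) (ι → ZMod 2) ℂ) : Prop :=
  ∃ (k : ℕ) (a b : ι → ZMod 2), g = Complex.I ^ k • pauli a b

/-- Additive (stabilizer) codes: joint `+1` eigenspaces of an Abelian subgroup of the Pauli group
which contains no non-trivial multiple of the identity. Other choices of the eigenvalues are
covered, the signs being absorbed in the group. -/
def IsStabilizerCode (Q : Submodule ℂ (Qubits ι)) : Prop :=
  ∃ S : Subgroup (Matrix (ι → ZMod 2) (ι → ZMod 2) ℂ)ˣ,
    (∀ g ∈ S, IsPauli g.val) ∧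
    (∀ g ∈ S, ∀ h ∈ S, g * h = h * g) ∧
    (∀ g ∈ S, ∀ c : ℂ, g.val = c • 1 → c = 1) ∧
    ∀ ψ : Qubits ι, ψ ∈ Q ↔ ∀ g ∈ S, Matrix.toEuclideanLin g.val ψ = ψ

/-- The condition that the code `Q` detects the Pauli error `(a|b)`. -/
def Detects (Q : Submodule ℂ (Qubits ι)) (a b : ι → ZMod 2) : Prop :=
  ∃ c : ℂ, ∀ φ ∈ Q, ∀ ψ ∈ Q, inner ℂ φ (pauliOp a b ψ) = c * inner ℂ φ ψ

/-- `d` is the minimum distance of `Q`: the least weight of a Pauli error not detected by `Q`. -/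
def HasMinDistance (Q : Submodule ℂ (Qubits ι)) (d : ℕ) : Prop :=
  IsLeast {w | ∃ a b : ι → ZMod 2, ¬ Detects Q a b ∧ pauliWeight a b = w} d

/-- `Q` is a quantum code `((n, K, d))`: a `K`-dimensional space of states of `n` qubits, of
minimum distance `d`. -/
def IsCode (Q : Submodule ℂ (Qubits ι)) (n K d : ℕ) : Prop :=
  Fintype.card ι = n ∧ Module.finrank ℂ Q = K ∧ HasMinDistance Q d

/-- The CSS code of `C₁`, `C₂` (where `C₂^⊥ ⊆ C₁`): its stabilizer is generated by the operators
`(a|0)` with `a ∈ C₂^⊥` and `(0|b)` with `b ∈ C₁^⊥`. -/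
def cssCode (C₁ C₂ : Submodule (ZMod 2) (ι → ZMod 2)) : Submodule ℂ (Qubits ι) :=
  (⨅ a ∈ dual C₂, LinearMap.eqLocus (pauliOp a 0) LinearMap.id) ⊓
    ⨅ b ∈ dual C₁, LinearMap.eqLocus (pauliOp 0 b) LinearMap.id

/-- The translate `t Q` of `Q` by the Pauli operator `t = (a|b)`. -/
def translate (Q : Submodule ℂ (Qubits ι)) (t : (ι → ZMod 2) × (ι → ZMod 2)) :
    Submodule ℂ (Qubits ι) :=
  Q.map (pauliOp t.1 t.2)

/-- The union code: the sum of the translates of `Q` by the elements of `T`. -/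
def unionCode (Q : Submodule ℂ (Qubits ι)) (T : Finset ((ι → ZMod 2) × (ι → ZMod 2))) :
    Submodule ℂ (Qubits ι) :=
  ⨆ t ∈ T, translate Q t

/-- The CSS-like union code: the union code of the CSS code of `C₁`, `C₂` with the translations
`(t₁|t₂)`, `t₁ ∈ T₁`, `t₂ ∈ T₂`. -/
def cssUnionCode (C₁ C₂ : Submodule (ZMod 2) (ι → ZMod 2)) (T₁ T₂ : Finset (ι → ZMod 2)) :
    Submodule ℂ (Qubits ι) :=
  unionCode (cssCode C₁ C₂) (T₁ ×ˢ T₂)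

end QCode

end

/-!
Write `m = 2k + 4`, so that `|F| = 2 ^ (2k + 3)`. The defining equations of the Goethals code say
that a linear moment map sends a word into a nonlinear set of targets, parametrized by
`S = ∑ x ∈ X, x`. The moment map kills `RM(m - 3, m)`, since a polynomial of degree below `m` sums
to zero over `𝔽₂ᵐ`, and it is surjective by nondegeneracy of the trace form. This makes `𝒢(m)` a
union of cosets and counts them.

The sum of two codewords of `𝒢(m)` satisfies, after a translation, the Goethals equations again. If
its weight is less than eight, then `X`, say, is empty or a pair. If it is empty, `∑ y ^ j = 0`
over `Y` for `j = 1, 2 ^ k + 1, 2 ^ (k + 1) + 1`; for `a ≠ b` in `Y` and the Frobenius power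
`σ y = y ^ 2 ^ (k + 2)`, the weight `(σ y - σ a) * (σ y - σ b)` vanishes at `a` and `b` and
annihilates `1, y, y ^ 2, y ^ 4` on the remaining at most four points, whose sum `a + b` is not
zero; so it vanishes identically, which is absurd. An affine change of variable reduces the case of
a pair to a similar argument.

The translates of a CSS code are the joint eigenspaces of its stabilizers for the various
characters. They are orthogonal for different characters, and Pauli operators permute them, so an
error that is not detected by the union code has an `X`-part or a `Z`-part that is a difference of
two distinct words of `𝒢(m)`. A word of weight eight in `R` outside `R^⊥` gives an undetected error of
weight eight. Finally, a stabilizer code that contains `ψ`, `E ψ` and `E' ψ`, for Pauli operators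
`E` and `E'`, contains `E E' ψ` as well, whereas `𝒢(m)` contains zero and is not closed under
addition.
-/

noncomputable section

namespace QCode

/-! ### Interpolation and power sums in characteristic two -/

section Interpolation

open Polynomial

variable {K : Type*} [Field K]

theorem sum_mul_eval_eq_zero {S : Finset K} {a : K → K} {P : K[X]}
    (h : ∀ j, P.coeff j ≠ 0 → ∑ y ∈ S, a y * y ^ j = 0) : ∑ y ∈ S, a y * P.eval y = 0 := by
  simp only [eval_eq_sum, Polynomial.sum, Finset.mul_sum, mul_left_comm (a _)]
  rw [Finset.sum_comm]
  refine Finset.sum_eq_zero fun j hj => ?_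
  rw [← Finset.mul_sum, h j (mem_support_iff.1 hj), mul_zero]

/-- The monomials `y ^ j` with `j ≤ #S`, `j ≠ #S - 1`, interpolate on `S`: multiplying
`∏ (X - s)`, `s ∈ S \ {p}`, by `X + ∑ s` cancels the coefficient of degree `#S - 1`, and the extra
factor takes the value `∑ s ∈ S, s` at `p`. -/
theorem eq_zero_of_sum_mul_pow_eq_zero {S : Finset K} {a : K → K} (hS : ∑ s ∈ S, s ≠ 0)
    (h : ∀ j ≤ S.card, j + 1 ≠ S.card → ∑ y ∈ S, a y * y ^ j = 0) : ∀ p ∈ S, a p = 0 := by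
  classical
  intro p hp
  set c := ∑ s ∈ S.erase p, s with hc
  set Q : K[X] := ∏ s ∈ S.erase p, (X - C s) with hQ
  have hQm : Q.Monic := monic_prod_X_sub_C _ _
  have hQd : Q.natDegree + 1 = S.card := by
    rw [hQ, natDegree_finsetProd_X_sub_C_eq_card, Finset.card_erase_add_one hp]
  have hPd : (Q * (X + C c)).natDegree = S.card := by
    rw [hQm.natDegree_mul (monic_X_add_C c), natDegree_X_add_C, hQd]
  have hP : (Q * (X + C c)).nextCoeff = 0 := by
    rw [hQm.nextCoeff_mul (monic_X_add_C c), hQ, prod_X_sub_C_nextCoeff, nextCoeff_X_add_C, hc,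
      neg_add_cancel]
  have hsum : ∑ y ∈ S, a y * (Q * (X + C c)).eval y = 0 := by
    refine sum_mul_eval_eq_zero fun j hj => h j ?_ fun hj' => hj ?_
    · exact (le_natDegree_of_ne_zero hj).trans hPd.le
    · rwa [nextCoeff_of_natDegree_pos (by omega), hPd, ← hj', Nat.add_sub_cancel] at hP
  rw [Finset.sum_eq_single_of_mem p hp] at hsum
  · refine (mul_eq_zero.1 hsum).resolve_right ?_
    rw [eval_mul, hQ, eval_prod, eval_add, eval_X, eval_C, hc,
      Finset.add_sum_erase S (fun s => s) hp]
    refine mul_ne_zero (Finset.prod_ne_zero_iff.2 fun s hs => ?_) hS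
    rw [eval_sub, eval_X, eval_C]
    exact sub_ne_zero.2 (Finset.ne_of_mem_erase hs).symm
  · intro y hy hyp
    rw [eval_mul, hQ, eval_prod, Finset.prod_eq_zero (Finset.mem_erase.2 ⟨hyp, hy⟩), zero_mul,
      mul_zero]
    rw [eval_sub, eval_X, eval_C, sub_self]

theorem eq_zero_of_four_moments {S : Finset K} {a : K → K} (hS : ∑ s ∈ S, s ≠ 0)
    (heven : Even S.card) (hcard : S.card ≤ 4) (h0 : ∑ y ∈ S, a y = 0)
    (hpow : ∀ j ≤ 2, ∑ y ∈ S, a y * y ^ 2 ^ j = 0) : ∀ p ∈ S, a p = 0 := by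
  have h1 := hpow 0 (by norm_num)
  have h2 := hpow 1 (by norm_num)
  have h4 := hpow 2 (by norm_num)
  norm_num at h1 h2 h4
  refine eq_zero_of_sum_mul_pow_eq_zero hS fun j hj hj' => ?_
  have : j = 0 ∨ j = 1 ∨ j = 2 ∨ j = 4 := by
    obtain ⟨n, hn⟩ := heven
    omega
  rcases this with rfl | rfl | rfl | rfl
  · simpa using h0
  · simpa using h1
  · exact h2
  · exact h4

end Interpolation

theorem sum_erase_erase_mul_eq_zero {A R : Type*} [DecidableEq A] [CommRing R] {Y : Finset A}
    {a b : A} (ha : a ∈ Y) (hb : b ∈ Y) (hab : a ≠ b) {σ f : A → R}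
    (h1 : ∑ y ∈ Y, σ y * f y = 0) (h2 : ∑ y ∈ Y, σ y ^ 2 * f y = 0) (h0 : ∑ y ∈ Y, f y = 0) :
    ∑ y ∈ (Y.erase a).erase b, (σ y - σ a) * (σ y - σ b) * f y = 0 := by
  have hexpand : ∀ y, (σ y - σ a) * (σ y - σ b) * f y =
      σ y ^ 2 * f y - (σ a + σ b) * (σ y * f y) + σ a * σ b * f y := fun y => by ring
  calc ∑ y ∈ (Y.erase a).erase b, (σ y - σ a) * (σ y - σ b) * f y
      = ∑ y ∈ Y, (σ y - σ a) * (σ y - σ b) * f y := by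
        rw [← Finset.add_sum_erase Y _ ha,
          ← Finset.add_sum_erase _ _ (Finset.mem_erase.2 ⟨hab.symm, hb⟩)]
        ring
    _ = 0 := by
        simp only [hexpand, Finset.sum_add_distrib, Finset.sum_sub_distrib, ← Finset.mul_sum, h0,
          h1, h2, mul_zero, sub_zero, add_zero]

section PowerSums

variable {R : Type*} [CommRing R] [CharP R 2] {Y : Finset R} {k : ℕ}

theorem sum_pow_two_pow (Y : Finset R) (n : ℕ) : ∑ y ∈ Y, y ^ 2 ^ n = (∑ y ∈ Y, y) ^ 2 ^ n :=
  (sum_pow_char_pow 2 n Y fun y => y).symm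

theorem sum_pow_two_pow_add_one_eq_zero_of_add {n n' : ℕ}
    (hR : ∀ x : R, x ^ 2 ^ (n + n') = x) (h : ∑ y ∈ Y, y ^ (2 ^ n + 1) = 0) :
    ∑ y ∈ Y, y ^ (2 ^ n' + 1) = 0 := by
  calc ∑ y ∈ Y, y ^ (2 ^ n' + 1) = ∑ y ∈ Y, (y ^ (2 ^ n + 1)) ^ 2 ^ n' :=
        Finset.sum_congr rfl fun y _ => by
          rw [pow_succ y (2 ^ n), mul_pow, ← pow_mul, ← pow_add 2, hR, pow_succ']
    _ = 0 := by rw [← sum_pow_char_pow 2, h, zero_pow (by positivity)]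

/-- All these exponents are conjugate, under the Frobenius map, to `2 ^ n + 1` with
`k ≤ n ≤ k + 3`. -/
theorem sum_mul_pow_two_pow_eq_zero (hR : ∀ x : R, x ^ 2 ^ (2 * k + 3) = x)
    (hr : ∑ y ∈ Y, y ^ (2 ^ k + 1) = 0) (hs : ∑ y ∈ Y, y ^ (2 ^ (k + 1) + 1) = 0) {i j : ℕ}
    (hi : i ≤ 1) (hj : j ≤ 2) : ∑ y ∈ Y, (y ^ 2 ^ (k + 2)) ^ 2 ^ i * y ^ 2 ^ j = 0 := by
  have hconj : ∀ n, k ≤ n → n ≤ k + 3 → ∑ y ∈ Y, y ^ (2 ^ n + 1) = 0 := by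
    intro n hn hn'
    obtain rfl | rfl | rfl | rfl : n = k ∨ n = k + 1 ∨ n = k + 2 ∨ n = k + 3 := by omega
    · exact hr
    · exact hs
    · refine sum_pow_two_pow_add_one_eq_zero_of_add (n := k + 1) (fun x => ?_) hs
      rw [show k + 1 + (k + 2) = 2 * k + 3 by ring, hR]
    · refine sum_pow_two_pow_add_one_eq_zero_of_add (n := k) (fun x => ?_) hr
      rw [show k + (k + 3) = 2 * k + 3 by ring, hR]
  obtain ⟨n, hn⟩ : ∃ n, k + 2 + i = n + j := ⟨k + 2 + i - j, by omega⟩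
  calc ∑ y ∈ Y, (y ^ 2 ^ (k + 2)) ^ 2 ^ i * y ^ 2 ^ j = ∑ y ∈ Y, (y ^ (2 ^ n + 1)) ^ 2 ^ j :=
        Finset.sum_congr rfl fun y _ => by
          rw [← pow_mul, ← pow_add 2, hn, pow_succ y (2 ^ n), mul_pow, ← pow_mul, ← pow_add 2]
    _ = 0 := by
      rw [← sum_pow_char_pow 2, hconj n (by omega) (by omega), zero_pow (by positivity)]

theorem cast_card_eq_zero_of_even (hY : Even Y.card) : (Y.card : R) = 0 :=
  (CharP.cast_eq_zero_iff R 2 _).2 hY.two_dvd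

theorem sum_affine_pow_two_pow_add_one (n : ℕ) (hY : Even Y.card) (l a : R) :
    ∑ y ∈ Y, (l * (y + a)) ^ (2 ^ n + 1) = l ^ (2 ^ n + 1) *
      (∑ y ∈ Y, y ^ (2 ^ n + 1) + a ^ 2 ^ n * ∑ y ∈ Y, y + a * (∑ y ∈ Y, y) ^ 2 ^ n) := by
  have hexpand : ∀ y : R, (l * (y + a)) ^ (2 ^ n + 1) = l ^ (2 ^ n + 1) *
      (y ^ (2 ^ n + 1) + a ^ 2 ^ n * y + a * y ^ 2 ^ n + a ^ (2 ^ n + 1)) := by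
    intro y
    rw [mul_pow, pow_succ (y + a), add_pow_char_pow]
    ring
  simp only [hexpand, ← Finset.mul_sum _ _ (l ^ (2 ^ n + 1)), Finset.sum_add_distrib,
    ← Finset.mul_sum _ _ (a ^ 2 ^ n), ← Finset.mul_sum _ _ a, Finset.sum_const, nsmul_eq_mul,
    cast_card_eq_zero_of_even hY, sum_pow_two_pow, zero_mul, add_zero]

end PowerSums

section GoethalsPairs

variable {F : Type*} [Field F] [CharP F 2] {X Y : Finset F} {k : ℕ}

theorem pow_two_pow_injective (n : ℕ) : Function.Injective fun y : F => y ^ 2 ^ n :=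
  fun x y h => iterateFrobenius_inj F 2 n (by simpa only [iterateFrobenius_def] using h)

/-- Choose `a ≠ b` in `Y` and let `σ y = y ^ 2 ^ (k + 2)`. The weight `(σ y - σ a) * (σ y - σ b)`
lives on the at most four points of `Y \ {a, b}`, whose sum is `a + b ≠ 0`. -/
theorem eq_empty_of_power_sums_eq_zero (hF : ∀ x : F, x ^ 2 ^ (2 * k + 3) = x)
    (hY : Even Y.card) (hcard : Y.card < 8) (h1 : ∑ y ∈ Y, y = 0)
    (hr : ∑ y ∈ Y, y ^ (2 ^ k + 1) = 0) (hs : ∑ y ∈ Y, y ^ (2 ^ (k + 1) + 1) = 0) : Y = ∅ := by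
  classical
  by_contra hne
  have htwo : 1 < Y.card := by
    have := Finset.card_ne_zero.2 (Finset.nonempty_iff_ne_empty.2 hne)
    obtain ⟨n, hn⟩ := hY
    omega
  obtain ⟨a, ha, b, hb, hab⟩ := Finset.one_lt_card.1 htwo
  have hba : b ∈ Y.erase a := Finset.mem_erase.2 ⟨hab.symm, hb⟩
  set S := (Y.erase a).erase b with hS
  have hScard : S.card + 2 = Y.card := by
    rw [← Finset.card_erase_add_one ha, ← Finset.card_erase_add_one hba]
  have hSeven : Even S.card := (Nat.even_add.1 (hScard ▸ hY)).2 even_two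
  have hSsum : ∑ s ∈ S, s ≠ 0 := fun h => hab <| CharTwo.add_eq_zero.1 <| by
    rw [← Finset.add_sum_erase Y _ ha, ← Finset.add_sum_erase _ _ hba, ← hS, h, add_zero] at h1
    exact h1
  let σ : F → F := fun y => y ^ 2 ^ (k + 2)
  have hlin : ∀ n, ∑ y ∈ Y, y ^ 2 ^ n = 0 := fun n => by
    rw [sum_pow_two_pow, h1, zero_pow (by positivity)]
  have hweight : ∀ p ∈ S, (σ p - σ a) * (σ p - σ b) = 0 := by
    refine eq_zero_of_four_moments (a := fun p => (σ p - σ a) * (σ p - σ b)) hSsum hSeven ?_ ?_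
      fun j hj => ?_
    · obtain ⟨n, hn⟩ := hSeven
      omega
    · have hlin' : ∑ y ∈ Y, σ y ^ 2 = 0 := by
        simpa only [σ, ← pow_mul, ← pow_succ] using hlin (k + 3)
      simpa using sum_erase_erase_mul_eq_zero (σ := σ) (f := fun _ => 1) ha hb hab
        (by simpa using hlin (k + 2)) (by simpa using hlin')
        (by simpa using cast_card_eq_zero_of_even hY)
    · refine sum_erase_erase_mul_eq_zero ha hb hab ?_ ?_ (hlin j)
      · simpa using sum_mul_pow_two_pow_eq_zero hF hr hs zero_le_one hj
      · simpa using sum_mul_pow_two_pow_eq_zero hF hr hs le_rfl hj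
  refine hSsum (Finset.sum_eq_zero fun p hp => ?_)
  rcases mul_eq_zero.1 (hweight p hp) with h | h
  · obtain rfl := pow_two_pow_injective (k + 2) (sub_eq_zero.1 h)
    simp [hS] at hp
  · obtain rfl := pow_two_pow_injective (k + 2) (sub_eq_zero.1 h)
    simp [hS] at hp

/-- With `σ y = y ^ 2 ^ (k + 2)`, the weight `σ + σ ^ 2` has vanishing moments on `Y`, which forces
`Y ⊆ {0, 1}`; there `y ^ (2 ^ k + 1) = y`. -/
theorem sum_ne_one_of_power_sums_eq_zero (hF : ∀ x : F, x ^ 2 ^ (2 * k + 3) = x)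
    (hY : Even Y.card) (hcard : Y.card ≤ 4) (hr : ∑ y ∈ Y, y ^ (2 ^ k + 1) = 0)
    (hs : ∑ y ∈ Y, y ^ (2 ^ (k + 1) + 1) = 0) : ∑ y ∈ Y, y ≠ 1 := by
  intro h1
  have hlin : ∀ n, ∑ y ∈ Y, y ^ 2 ^ n = 1 := fun n => by rw [sum_pow_two_pow, h1, one_pow]
  have hw : ∀ p ∈ Y, p ^ 2 ^ (k + 2) + (p ^ 2 ^ (k + 2)) ^ 2 = 0 := by
    refine eq_zero_of_four_moments (h1 ▸ one_ne_zero) hY hcard ?_ fun j hj => ?_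
    · simp only [Finset.sum_add_distrib, ← pow_mul, ← pow_succ, hlin]
      exact CharTwo.add_self_eq_zero 1
    · have hσ := sum_mul_pow_two_pow_eq_zero hF hr hs zero_le_one hj
      have hσ2 := sum_mul_pow_two_pow_eq_zero hF hr hs le_rfl hj
      simp only [pow_zero, pow_one] at hσ hσ2
      rw [Finset.sum_congr rfl fun y _ => add_mul _ _ _, Finset.sum_add_distrib, hσ, hσ2, add_zero]
  have hzero_one : ∀ p ∈ Y, p = 0 ∨ p = 1 := by
    intro p hp
    have hmul : p ^ 2 ^ (k + 2) * (1 + p ^ 2 ^ (k + 2)) = 0 := by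
      linear_combination hw p hp
    rcases mul_eq_zero.1 hmul with h | h
    · exact Or.inl (eq_zero_of_pow_eq_zero h)
    · refine Or.inr (pow_two_pow_injective (k + 2) ?_)
      simpa using (CharTwo.add_eq_zero.1 h).symm
  refine one_ne_zero (h1.symm.trans ((Finset.sum_congr rfl fun p hp => ?_).trans hr))
  rcases hzero_one p hp with rfl | rfl <;> simp

/-- The affine map sending the two points of `X` to `0` and `1` turns the equations into the case
of power sums `1`, `0`, `0`. -/
theorem card_ne_two_of_goethals_pair (hF : ∀ x : F, x ^ 2 ^ (2 * k + 3) = x) (hY : Even Y.card)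
    (hcard : Y.card ≤ 4) (h1 : ∑ x ∈ X, x = ∑ y ∈ Y, y)
    (hpow : ∀ n ∈ ({k, k + 1} : Set ℕ),
      ∑ x ∈ X, x ^ (2 ^ n + 1) + (∑ x ∈ X, x) ^ (2 ^ n + 1) = ∑ y ∈ Y, y ^ (2 ^ n + 1)) :
    X.card ≠ 2 := by
  classical
  intro h
  obtain ⟨x, x', hxx, rfl⟩ := Finset.card_eq_two.1 h
  simp only [Finset.sum_pair hxx] at h1 hpow
  set S := x + x' with hS
  have hS0 : S ≠ 0 := fun h0 => hxx (CharTwo.add_eq_zero.1 h0)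
  have hx' : x' = x + S := by rw [hS, CharTwo.add_cancel_left]
  have hinj : Function.Injective fun y : F => S⁻¹ * (y + x) :=
    (mul_right_injective₀ (inv_ne_zero hS0)).comp (add_left_injective x)
  have hzero : ∀ n ∈ ({k, k + 1} : Set ℕ),
      ∑ y ∈ Y.image fun y => S⁻¹ * (y + x), y ^ (2 ^ n + 1) = 0 := by
    intro n hn
    rw [Finset.sum_image hinj.injOn, sum_affine_pow_two_pow_add_one n hY, ← hpow n hn, ← h1, hx',
      pow_succ (x + S), add_pow_char_pow]
    linear_combination S⁻¹ ^ (2 ^ n + 1) * (x ^ (2 ^ n + 1) + S ^ (2 ^ n + 1) + x ^ 2 ^ n * S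
      + S ^ 2 ^ n * x) * CharTwo.two_eq_zero (R := F)
  refine sum_ne_one_of_power_sums_eq_zero (Y := Y.image fun y => S⁻¹ * (y + x)) hF
    (by rwa [Finset.card_image_of_injective _ hinj])
    (by rwa [Finset.card_image_of_injective _ hinj]) (hzero k (by simp))
    (hzero (k + 1) (by simp)) ?_
  rw [Finset.sum_image hinj.injOn, ← Finset.mul_sum, Finset.sum_add_distrib, ← h1, Finset.sum_const,
    nsmul_eq_mul, cast_card_eq_zero_of_even hY, zero_mul, add_zero, inv_mul_cancel₀ hS0]

theorem goethals_pair_eq_empty (hF : ∀ x : F, x ^ 2 ^ (2 * k + 3) = x) (hX : Even X.card)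
    (hY : Even Y.card) (hcard : X.card + Y.card < 8) (h1 : ∑ x ∈ X, x = ∑ y ∈ Y, y)
    (hpow : ∀ n ∈ ({k, k + 1} : Set ℕ),
      ∑ x ∈ X, x ^ (2 ^ n + 1) + (∑ x ∈ X, x) ^ (2 ^ n + 1) = ∑ y ∈ Y, y ^ (2 ^ n + 1)) :
    X = ∅ ∧ Y = ∅ := by
  wlog hle : X.card ≤ Y.card generalizing X Y
  · refine (this hY hX (by omega) h1.symm (fun n hn => ?_) (by omega)).symm
    rw [← hpow n hn, ← h1, add_assoc, CharTwo.add_self_eq_zero, add_zero]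
  have hX0 : X.card = 0 ∨ X.card = 2 ∧ Y.card ≤ 4 := by
    obtain ⟨i, hi⟩ := hX
    obtain ⟨j, hj⟩ := hY
    omega
  rcases hX0 with hX0 | ⟨hX2, hY4⟩
  · obtain rfl := Finset.card_eq_zero.1 hX0
    have hpow0 : ∀ n ∈ ({k, k + 1} : Set ℕ), ∑ y ∈ Y, y ^ (2 ^ n + 1) = 0 := fun n hn => by
      simpa using (hpow n hn).symm
    exact ⟨rfl, eq_empty_of_power_sums_eq_zero hF hY (by omega) (by simpa using h1.symm)
      (hpow0 k (by simp)) (hpow0 (k + 1) (by simp))⟩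
  · exact absurd hX2 (card_ne_two_of_goethals_pair hF hY hY4 h1 hpow)

end GoethalsPairs

/-! ### Duality of binary codes -/

section Dual

variable {ι : Type*} [Fintype ι] {C : Submodule (ZMod 2) (ι → ZMod 2)}

theorem mem_dual {v : ι → ZMod 2} : v ∈ dual C ↔ ∀ c ∈ C, v ⬝ᵥ c = 0 := Iff.rfl

theorem dual_eq_orthogonal :
    dual C = LinearMap.BilinForm.orthogonal (dotProductBilin (ZMod 2) (ZMod 2)) C := by
  ext v
  simp only [mem_dual, LinearMap.BilinForm.mem_orthogonal_iff, dotProduct_comm v]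
  rfl

theorem nondegenerate_dotProductBilin : LinearMap.BilinForm.Nondegenerate
    (dotProductBilin (ZMod 2) (ZMod 2) : LinearMap.BilinForm (ZMod 2) (ι → ZMod 2)) := by
  classical
  constructor
  · intro v h
    funext i
    simpa using h (Pi.single i 1)
  · intro v h
    funext i
    simpa using h (Pi.single i 1)

theorem finrank_dual_add_finrank :
    Module.finrank (ZMod 2) (dual C) + Module.finrank (ZMod 2) C = Fintype.card ι := by
  rw [dual_eq_orthogonal, LinearMap.BilinForm.finrank_orthogonal nondegenerate_dotProductBilin,
    Nat.sub_add_cancel (Submodule.finrank_le C), Module.finrank_fintype_fun_eq_card]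

theorem dual_dual : dual (dual C) = C := by
  rw [dual_eq_orthogonal, dual_eq_orthogonal]
  exact LinearMap.BilinForm.orthogonal_orthogonal nondegenerate_dotProductBilin
    (fun v w h => (dotProduct_comm w v).trans h) C

theorem exists_mem_dual_dotProduct_ne {u u' : ι → ZMod 2} (h : u - u' ∉ C) :
    ∃ a ∈ dual C, u ⬝ᵥ a ≠ u' ⬝ᵥ a := by
  rw [← dual_dual (C := C), mem_dual] at h
  push Not at h
  obtain ⟨a, ha, hne⟩ := h
  exact ⟨a, ha, fun heq => hne (by rw [sub_dotProduct, heq, sub_self])⟩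

end Dual

/-! ### Reed–Muller codes -/

theorem zmod_two_eq_zero_or_one (z : ZMod 2) : z = 0 ∨ z = 1 := by revert z; decide

theorem zmod_two_ne_zero_iff {z : ZMod 2} : z ≠ 0 ↔ z = 1 := by revert z; decide

theorem zmod_two_pow (z : ZMod 2) {n : ℕ} (hn : n ≠ 0) : z ^ n = z := by
  rcases zmod_two_eq_zero_or_one z with rfl | rfl <;> simp [hn]

theorem sum_zmod_two {A : Type*} [AddCommMonoid A] (f : ZMod 2 → A) : ∑ z, f z = f 0 + f 1 :=
  Fin.sum_univ_two f

section ReedMuller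

variable {m r s : ℕ} {c d : (Fin m → ZMod 2) → ZMod 2}

/-- The evaluation on `𝔽₂ᵐ` of the square-free monomial with set of variables `S`. These words
with `#S ≤ r` form the standard basis of `RM(r, m)`. -/
def monomialWord (S : Finset (Fin m)) : (Fin m → ZMod 2) → ZMod 2 := fun v => ∏ i ∈ S, v i

theorem mem_reedMuller : c ∈ reedMuller r m ↔
    ∃ p : MvPolynomial (Fin m) (ZMod 2), p.totalDegree ≤ r ∧ ∀ v, MvPolynomial.eval v p = c v := by
  simp only [reedMuller, Submodule.mem_map, MvPolynomial.mem_restrictTotalDegree, funext_iff,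
    MvPolynomial.evalₗ_apply]

theorem reedMuller_mono (h : r ≤ s) : reedMuller r m ≤ reedMuller s m := by
  intro c hc
  obtain ⟨p, hp, hpc⟩ := mem_reedMuller.1 hc
  exact mem_reedMuller.2 ⟨p, hp.trans h, hpc⟩

theorem monomialWord_mem_reedMuller {S : Finset (Fin m)} (hS : S.card ≤ r) :
    monomialWord S ∈ reedMuller r m := by
  refine mem_reedMuller.2 ⟨∏ i ∈ S, MvPolynomial.X i, ?_, fun v => by simp [monomialWord]⟩
  exact (MvPolynomial.totalDegree_finsetProd _ _).trans (by simpa using hS)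

theorem evalₗ_eq_sum_monomialWord (p : MvPolynomial (Fin m) (ZMod 2)) :
    MvPolynomial.evalₗ (ZMod 2) (Fin m) p =
      ∑ d ∈ p.support, p.coeff d • monomialWord d.support := by
  funext v
  rw [MvPolynomial.evalₗ_apply, MvPolynomial.eval_eq, Finset.sum_apply]
  refine Finset.sum_congr rfl fun d _ => congrArg (p.coeff d * ·) ?_
  exact Finset.prod_congr rfl fun i hi => zmod_two_pow (v i) (Finsupp.mem_support_iff.1 hi)

theorem reedMuller_eq_span (r : ℕ) :
    reedMuller r m = Submodule.span (ZMod 2)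
      (Set.range fun S : {S : Finset (Fin m) // S.card ≤ r} => monomialWord S.1) := by
  refine le_antisymm ?_ (Submodule.span_le.2 ?_)
  · rintro _ ⟨p, hp, rfl⟩
    rw [evalₗ_eq_sum_monomialWord]
    refine Submodule.sum_mem _ fun d hd => Submodule.smul_mem _ _ (Submodule.subset_span ?_)
    refine ⟨⟨d.support, le_trans ?_ ((MvPolynomial.le_totalDegree hd).trans
      ((MvPolynomial.mem_restrictTotalDegree _ _ p).1 hp))⟩, rfl⟩
    rw [Finset.card_eq_sum_ones, Finsupp.sum]
    exact Finset.sum_le_sum fun i hi => Nat.one_le_iff_ne_zero.2 (Finsupp.mem_support_iff.1 hi)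
  · rintro _ ⟨S, rfl⟩
    exact monomialWord_mem_reedMuller S.2

theorem linearIndependent_monomialWord :
    LinearIndependent (ZMod 2) (monomialWord : Finset (Fin m) → _) := by
  refine linearIndependent_of_top_le_span_of_card_eq_finrank ?_ (by simp [ZMod.card])
  rw [← MvPolynomial.map_restrict_dom_evalₗ]
  rintro _ ⟨p, -, rfl⟩
  rw [evalₗ_eq_sum_monomialWord]
  exact Submodule.sum_mem _ fun d _ =>
    Submodule.smul_mem _ _ (Submodule.subset_span ⟨d.support, rfl⟩)

theorem finrank_reedMuller (r : ℕ) :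
    Module.finrank (ZMod 2) (reedMuller r m) = ∑ i ∈ Finset.range (r + 1), m.choose i := by
  have hfilter : (Finset.univ.filter fun S : Finset (Fin m) => S.card ≤ r) =
      (Finset.range (r + 1)).biUnion fun j => Finset.powersetCard j Finset.univ := by
    ext S
    simp [Finset.mem_powersetCard]
  rw [reedMuller_eq_span, finrank_span_eq_card (b := fun S : {S // S.card ≤ r} => monomialWord S.1)
    (linearIndependent_monomialWord.comp _ Subtype.val_injective), Fintype.card_subtype, hfilter,
    Finset.card_biUnion ((Finset.pairwise_disjoint_powersetCard _).set_pairwise _)]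
  simp only [Finset.card_powersetCard, Finset.card_univ, Fintype.card_fin]

theorem dotProduct_eq_zero_of_mem_reedMuller (h : r + s < m) (hc : c ∈ reedMuller r m)
    (hd : d ∈ reedMuller s m) : c ⬝ᵥ d = 0 := by
  obtain ⟨p, hp, hpc⟩ := mem_reedMuller.1 hc
  obtain ⟨q, hq, hqd⟩ := mem_reedMuller.1 hd
  have hsum := MvPolynomial.sum_eval_eq_zero (p * q) <| by
    refine (MvPolynomial.totalDegree_mul p q).trans_lt ?_
    rw [ZMod.card, Fintype.card_fin]
    omega
  simpa only [map_mul, hpc, hqd, dotProduct] using hsum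

theorem dual_reedMuller (h : r + s + 1 = m) : dual (reedMuller r m) = reedMuller s m := by
  refine (Submodule.eq_of_le_of_finrank_eq (fun c hc => mem_dual.2 fun d hd =>
    dotProduct_eq_zero_of_mem_reedMuller (by omega) hc hd) ?_).symm
  have hchoose : ∑ i ∈ Finset.range (r + 1), m.choose i + ∑ i ∈ Finset.range (s + 1), m.choose i =
      2 ^ m := by
    rw [← Nat.sum_range_choose, show m + 1 = r + 1 + (s + 1) by omega,
      Finset.sum_range_add (fun i => m.choose i) (r + 1) (s + 1),
      ← Finset.sum_range_reflect (fun i => m.choose i) (s + 1)]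
    refine congrArg _ (Finset.sum_congr rfl fun i hi => Nat.choose_symm_of_eq_add ?_)
    have := Finset.mem_range.1 hi
    omega
  have hdual := finrank_dual_add_finrank (C := reedMuller r m)
  rw [Fintype.card_fun, ZMod.card, Fintype.card_fin] at hdual
  rw [finrank_reedMuller] at hdual ⊢
  omega

theorem sum_smul_prod_eq_zero {A κ : Type*} [CommRing A] [Algebra (ZMod 2) A] [Fintype κ]
    (h : r + Fintype.card κ < m) (hc : c ∈ reedMuller r m)
    (f : κ → (Fin m → ZMod 2) →ₗ[ZMod 2] A) : ∑ v, c v • ∏ k, f k v = 0 := by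
  classical
  let a : κ → Fin m → A := fun k i => f k fun j => if i = j then 1 else 0
  have hcoord : ∀ p : κ → Fin m, ∑ v, c v * ∏ k, v (p k) = 0 := by
    intro p
    refine dotProduct_eq_zero_of_mem_reedMuller h hc (d := fun v => ∏ k, v (p k))
      (mem_reedMuller.2 ⟨∏ k, MvPolynomial.X (p k), ?_, by simp⟩)
    exact (MvPolynomial.totalDegree_finsetProd _ _).trans (by simp)
  calc ∑ v, c v • ∏ k, f k v
      = ∑ v : Fin m → ZMod 2, ∑ p : κ → Fin m, (c v * ∏ k, v (p k)) • ∏ k, a k (p k) := by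
        refine Finset.sum_congr rfl fun v _ => ?_
        simp only [LinearMap.pi_apply_eq_sum_univ (f _) v, Fintype.prod_sum, Finset.prod_smul,
          Finset.smul_sum, smul_smul, a]
    _ = ∑ p : κ → Fin m, (∑ v : Fin m → ZMod 2, c v * ∏ k, v (p k)) • ∏ k, a k (p k) := by
        rw [Finset.sum_comm]
        simp only [Finset.sum_smul]
    _ = 0 := by simp only [hcoord, zero_smul, Finset.sum_const_zero]

theorem monomialWord_dotProduct_prod_compl {S T : Finset (Fin m)} (h : T.card ≤ S.card)
    (u : Fin m → ZMod 2) :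
    monomialWord T ⬝ᵥ (fun v => ∏ i ∈ Sᶜ, (v i + u i)) = if T = S then 1 else 0 := by
  have hfactor : monomialWord T ⬝ᵥ (fun v => ∏ i ∈ Sᶜ, (v i + u i)) =
      ∏ i, ∑ z, (if i ∈ T then z else 1) * if i ∈ Sᶜ then z + u i else 1 := by
    simp only [dotProduct, monomialWord, Finset.prod_univ_sum, Fintype.piFinset_univ,
      Finset.prod_mul_distrib, Finset.prod_ite_mem, Finset.univ_inter]
  rw [hfactor]
  split_ifs with hTS
  · subst hTS
    refine Finset.prod_eq_one fun i _ => ?_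
    by_cases hi : i ∈ T
    · simp [hi, sum_zmod_two]
    · simp only [hi, Finset.mem_compl, not_false_eq_true, if_true, if_false, sum_zmod_two]
      linear_combination u i * CharTwo.two_eq_zero (R := ZMod 2)
  · obtain ⟨i, hiS, hiT⟩ := Finset.not_subset.1 fun hsub =>
      hTS (Finset.eq_of_subset_of_card_le hsub h).symm
    refine Finset.prod_eq_zero (Finset.mem_univ i) ?_
    simpa [hiS, hiT] using CharTwo.two_eq_zero (R := ZMod 2)

theorem dotProduct_monomialWord_compl (S : Finset (Fin m)) :
    monomialWord S ⬝ᵥ monomialWord Sᶜ = 1 := by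
  simpa [monomialWord, dotProduct] using monomialWord_dotProduct_prod_compl (le_refl S.card) 0

/-- Take for `S` a monomial of maximal degree in `c`: whatever values are given to the variables
outside `S`, the remaining polynomial has leading monomial `S`. -/
theorem exists_dotProduct_prod_compl_eq_one (hc : c ∈ reedMuller r m) (hc0 : c ≠ 0) :
    ∃ S : Finset (Fin m), S.card ≤ r ∧ ∀ u : Fin m → ZMod 2,
      c ⬝ᵥ (fun v => ∏ i ∈ Sᶜ, (v i + u i)) = 1 := by
  rw [reedMuller_eq_span, Submodule.mem_span_range_iff_exists_fun] at hc
  obtain ⟨a, rfl⟩ := hc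
  have hsupport : (Finset.univ.filter fun S => a S ≠ 0).Nonempty := by
    obtain ⟨S, -, hS⟩ := Finset.exists_ne_zero_of_sum_ne_zero hc0
    exact ⟨S, by simpa using left_ne_zero_of_smul hS⟩
  obtain ⟨S, hS, hmax⟩ := Finset.exists_max_image _ (fun S => S.1.card) hsupport
  refine ⟨S.1, S.2, fun u => ?_⟩
  rw [sum_dotProduct, Finset.sum_eq_single_of_mem S (Finset.mem_univ S) fun T _ hTS => ?_]
  · rw [smul_dotProduct, monomialWord_dotProduct_prod_compl le_rfl, if_pos rfl,
      zmod_two_ne_zero_iff.1 (Finset.mem_filter.1 hS).2, one_smul]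
  · by_cases hT : a T = 0
    · rw [hT, zero_smul, zero_dotProduct]
    · rw [smul_dotProduct, monomialWord_dotProduct_prod_compl (hmax T (by simpa using hT)),
        if_neg (Subtype.coe_ne_coe.2 hTS), smul_zero]

theorem two_pow_le_hammingNorm_of_mem_reedMuller (hc : c ∈ reedMuller r m) (hc0 : c ≠ 0) :
    2 ^ (m - r) ≤ hammingNorm c := by
  obtain ⟨S, hS, hdot⟩ := exists_dotProduct_prod_compl_eq_one hc hc0
  have hexists : ∀ t : {i // i ∈ Sᶜ} → ZMod 2, ∃ v, c v ≠ 0 ∧ ∀ i, v i.1 = t i := by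
    intro t
    let u : Fin m → ZMod 2 := fun i => if hi : i ∈ Sᶜ then t ⟨i, hi⟩ + 1 else 0
    obtain ⟨v, -, hv⟩ := Finset.exists_ne_zero_of_sum_ne_zero ((hdot u).trans_ne one_ne_zero)
    refine ⟨v, left_ne_zero_of_mul hv, fun i => ?_⟩
    have hi := zmod_two_ne_zero_iff.1 (Finset.prod_ne_zero_iff.1 (right_ne_zero_of_mul hv) i i.2)
    simp only [u, dif_pos i.2, ← add_assoc] at hi
    exact CharTwo.add_eq_zero.1 (add_eq_right.1 hi)
  choose v hv hvt using hexists
  calc 2 ^ (m - r) ≤ 2 ^ (m - S.card) := Nat.pow_le_pow_right two_pos (by omega)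
    _ = Fintype.card ({i // i ∈ Sᶜ} → ZMod 2) := by
        rw [Fintype.card_fun, ZMod.card, Fintype.card_coe, Finset.card_compl, Fintype.card_fin]
    _ ≤ hammingNorm c := Finset.card_le_card_of_injOn v (fun t _ => by simpa using hv t)
        fun t _ t' _ h => funext fun i =>
          (hvt t i).symm.trans ((congrFun h i.1).trans (hvt t' i))

theorem pairwise_reedMuller_two_pow_le_hammingDist (r m : ℕ) :
    (reedMuller r m : Set ((Fin m → ZMod 2) → ZMod 2)).Pairwise fun c c' =>
      2 ^ (m - r) ≤ hammingDist c c' := by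
  intro c hc c' hc' hne
  rw [hammingDist_eq_hammingNorm, neg_add_eq_sub]
  exact two_pow_le_hammingNorm_of_mem_reedMuller (Submodule.sub_mem _ hc' hc)
    (sub_ne_zero.2 hne.symm)

theorem hammingNorm_monomialWord (S : Finset (Fin m)) :
    hammingNorm (monomialWord S) = 2 ^ (m - S.card) := by
  have hsupport : (Finset.univ.filter fun v => monomialWord S v ≠ 0) =
      Fintype.piFinset fun i => if i ∈ S then ({1} : Finset (ZMod 2)) else Finset.univ := by
    ext v
    simp only [Finset.mem_filter, Finset.mem_univ, true_and, Fintype.mem_piFinset, monomialWord,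
      Finset.prod_ne_zero_iff, zmod_two_ne_zero_iff]
    refine forall_congr' fun i => ?_
    split_ifs with hi <;> simp [hi]
  rw [hammingNorm, hsupport, Fintype.card_piFinset]
  simp only [apply_ite Finset.card, Finset.card_singleton, Finset.card_univ, ZMod.card]
  rw [Finset.prod_ite, Finset.prod_const_one, Finset.prod_const, one_mul, Finset.filter_not,
    Finset.filter_univ_mem, ← Finset.compl_eq_univ_sdiff, Finset.card_compl, Fintype.card_fin]

end ReedMuller

/-! ### Power moments of subsets of a finite field -/

theorem eq_zero_of_forall_sum_mul_pow_eq_zero {K κ : Type*} [CommRing K] [IsDomain K] [Fintype K]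
    [Fintype κ] {n : κ → ℕ} (hn : Function.Injective n) (hcard : ∀ i, n i < Fintype.card K)
    {c : κ → K} (h : ∀ x, ∑ i, c i * x ^ n i = 0) : c = 0 := by
  classical
  let p : Polynomial K := ∑ i, Polynomial.monomial (n i) (c i)
  have hdeg : p.natDegree < Fintype.card K :=
    Nat.lt_of_le_pred Fintype.card_pos <| Polynomial.natDegree_sum_le_of_forall_le _ _ fun i _ =>
      (Polynomial.natDegree_monomial_le _).trans (Nat.le_pred_of_lt (hcard i))
  have hp : p = 0 := Polynomial.eq_zero_of_natDegree_lt_card_of_eval_eq_zero p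
    Function.injective_id (fun x => by simpa [p, Polynomial.eval_finsetSum] using h x) hdeg
  funext i
  have hcoeff := congrArg (fun q => q.coeff (n i)) hp
  simpa [p, Polynomial.finsetSum_coeff, Polynomial.coeff_monomial, hn.eq_iff] using hcoeff

section PowerMoments

variable {F : Type*} [Field F] [Algebra (ZMod 2) F]

theorem trace_pow_two_pow [Finite F] (n : ℕ) (z : F) :
    Algebra.trace (ZMod 2) F (z ^ 2 ^ n) = Algebra.trace (ZMod 2) F z := by
  induction n with
  | zero => rw [pow_zero, pow_one]
  | succ n ih =>
    have hfrob := Algebra.trace_eq_of_algEquiv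
      (FiniteField.frobeniusAlgEquivOfAlgebraic (ZMod 2) F) (z ^ 2 ^ n)
    rw [← ih, ← hfrob, pow_succ, pow_mul]
    simp

theorem polarization_eq_zero {A : Type*} [AddCommGroup A] [Module (ZMod 2) A] {i j : ℕ}
    (l : ZMod 2 × F × F × F →ₗ[ZMod 2] A)
    (h : ∀ y, l (1, y, y ^ (2 ^ i + 1), y ^ (2 ^ j + 1)) = 0) (x y : F) :
    l (0, 0, x ^ 2 ^ i * y + x * y ^ 2 ^ i, x ^ 2 ^ j * y + x * y ^ 2 ^ j) = 0 := by
  have : CharP F 2 := charP_of_injective_algebraMap' (ZMod 2) 2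
  have hexpand : ∀ n, (x + y) ^ (2 ^ n + 1) =
      x ^ (2 ^ n + 1) + y ^ (2 ^ n + 1) + (x ^ 2 ^ n * y + x * y ^ 2 ^ n) := by
    intro n
    rw [pow_succ, add_pow_char_pow]
    ring
  have hzero : l (1, 0, 0, 0) = 0 := by simpa using h 0
  have hsum : ((0, 0, x ^ 2 ^ i * y + x * y ^ 2 ^ i, x ^ 2 ^ j * y + x * y ^ 2 ^ j) :
      ZMod 2 × F × F × F) =
      (1, x + y, (x + y) ^ (2 ^ i + 1), (x + y) ^ (2 ^ j + 1)) -
      (1, x, x ^ (2 ^ i + 1), x ^ (2 ^ j + 1)) - (1, y, y ^ (2 ^ i + 1), y ^ (2 ^ j + 1)) +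
      (1, 0, 0, 0) := by
    simp only [Prod.mk_sub_mk, Prod.mk_add_mk, hexpand]
    refine Prod.ext ?_ (Prod.ext ?_ (Prod.ext ?_ ?_)) <;> dsimp only <;> ring
  rw [hsum, map_add, map_sub, map_sub, h, h, h, hzero]
  simp

variable [Fintype F] {k : ℕ}

/-- Frobenius invariance of the trace moves the exponent `2 ^ i` from `y` to its cofactor. -/
theorem trace_mul_polarization {i j : ℕ} (hF : Fintype.card F = 2 ^ (i + j)) (b x y : F) :
    Algebra.trace (ZMod 2) F (b * (x ^ 2 ^ i * y + x * y ^ 2 ^ i)) =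
      Algebra.trace (ZMod 2) F ((b * x ^ 2 ^ i + (b * x) ^ 2 ^ j) * y) := by
  have hy : (y ^ 2 ^ i) ^ 2 ^ j = y := by rw [← pow_mul, ← pow_add, ← hF, FiniteField.pow_card]
  rw [mul_add, add_mul, map_add, map_add, mul_assoc, ← mul_assoc b x (y ^ 2 ^ i),
    ← trace_pow_two_pow j (b * x * y ^ 2 ^ i), mul_pow, hy]

theorem eq_zero_of_forall_polarization (hk : 1 ≤ k) (hF : Fintype.card F = 2 ^ (2 * k + 3))
    {l₁ l₂ : F →ₗ[ZMod 2] ZMod 2}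
    (h : ∀ x y, l₁ (x ^ 2 ^ k * y + x * y ^ 2 ^ k) +
      l₂ (x ^ 2 ^ (k + 1) * y + x * y ^ 2 ^ (k + 1)) = 0) : l₁ = 0 ∧ l₂ = 0 := by
  have hnd := traceForm_nondegenerate (ZMod 2) F
  have hrepr : ∀ l : F →ₗ[ZMod 2] ZMod 2, ∃ b, l = Algebra.traceForm (ZMod 2) F b := fun l =>
    ⟨_, ((Algebra.traceForm (ZMod 2) F).toDual hnd).apply_symm_apply l |>.symm⟩
  obtain ⟨b, rfl⟩ := hrepr l₁
  obtain ⟨c, rfl⟩ := hrepr l₂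
  have hlin : ∀ x, ∑ i : Fin 4, ![b, c, c ^ 2 ^ (k + 2), b ^ 2 ^ (k + 3)] i *
      x ^ 2 ^ (k + i : ℕ) = 0 := by
    intro x
    refine hnd.1 _ fun y => ?_
    have hxy := h x y
    rw [Algebra.traceForm_apply, Algebra.traceForm_apply,
      trace_mul_polarization (j := k + 3) (by rw [hF]; ring_nf),
      trace_mul_polarization (j := k + 2) (by rw [hF]; ring_nf), ← map_add, mul_pow, mul_pow] at hxy
    rw [Algebra.traceForm_apply, ← hxy]
    congr 1
    simp only [Fin.sum_univ_four, Matrix.cons_val, Fin.isValue, Fin.coe_ofNat_eq_mod,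
      Nat.reduceMod, add_zero]
    ring
  have hcoeff := eq_zero_of_forall_sum_mul_pow_eq_zero
    (fun i j hij => Fin.ext (by simpa using hij))
    (fun i => by rw [hF]; exact Nat.pow_lt_pow_right one_lt_two (by omega)) hlin
  have hb : b = 0 := congrFun hcoeff 0
  have hc : c = 0 := congrFun hcoeff 1
  rw [hb, hc, map_zero]
  exact ⟨rfl, rfl⟩

/-- The cardinality modulo two and the power sums with exponents `1`, `2 ^ k + 1` and
`2 ^ (k + 1) + 1` of a subset of `F`, given by its indicator function. -/
def powerMoments (F : Type*) [Field F] [Fintype F] [Algebra (ZMod 2) F] (k : ℕ) :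
    (F → ZMod 2) →ₗ[ZMod 2] ZMod 2 × F × F × F :=
  Fintype.linearCombination (ZMod 2) fun y => (1, y, y ^ (2 ^ k + 1), y ^ (2 ^ (k + 1) + 1))

theorem powerMoments_surjective (hk : 1 ≤ k) (hF : Fintype.card F = 2 ^ (2 * k + 3)) :
    Function.Surjective (powerMoments F k) := by
  classical
  rw [← LinearMap.range_eq_top]
  by_contra hne
  obtain ⟨l, hl0, hl⟩ := Submodule.exists_le_ker_of_lt_top _ (lt_top_iff_ne_top.2 hne)
  have hvanish : ∀ y : F, l (1, y, y ^ (2 ^ k + 1), y ^ (2 ^ (k + 1) + 1)) = 0 := by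
    intro y
    have hy := hl ⟨Pi.single y 1, rfl⟩
    simpa [powerMoments, Fintype.linearCombination_apply_single] using hy
  obtain ⟨h₂, h₃⟩ := eq_zero_of_forall_polarization hk hF
    (l₁ := l ∘ₗ .inr _ _ _ ∘ₗ .inr _ _ _ ∘ₗ .inl _ _ _)
    (l₂ := l ∘ₗ .inr _ _ _ ∘ₗ .inr _ _ _ ∘ₗ .inr _ _ _) fun x y => by
      simpa [← map_add] using polarization_eq_zero l hvanish x y
  have hdrop : ∀ a y u v, l (a, y, u, v) = l (a, y, 0, 0) := by
    intro a y u v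
    have hu : l (0, 0, u, 0) = 0 := LinearMap.congr_fun h₂ u
    have hv : l (0, 0, 0, v) = 0 := LinearMap.congr_fun h₃ v
    rw [show ((a, y, u, v) : ZMod 2 × F × F × F) = (a, y, 0, 0) + (0, 0, u, 0) + (0, 0, 0, v) by
      simp, map_add, map_add, hu, hv, add_zero, add_zero]
  have hline : ∀ y, l (1, y, 0, 0) = 0 := fun y => (hdrop 1 y _ _).symm.trans (hvanish y)
  refine hl0 (LinearMap.ext fun ⟨a, y, u, v⟩ => ?_)
  rw [hdrop, show ((a, y, 0, 0) : ZMod 2 × F × F × F) =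
    (1, y, 0, 0) + (a - 1) • (1, 0, 0, 0) by simp, map_add, map_smul, hline, hline]
  simp

end PowerMoments

/-! ### Goethals codes -/

section HalfSum

variable {m : ℕ} {F : Type*} [Field F] [Fintype F] (e : (Fin m → ZMod 2) ≃+ F × ZMod 2)

/-- The sum of the values of `φ` at the points of the half of a word labelled by `ε`, as a linear
function of the word. -/
def halfSum {A : Type*} [AddCommGroup A] [Module (ZMod 2) A] (φ : F → A) (ε : ZMod 2) :
    ((Fin m → ZMod 2) → ZMod 2) →ₗ[ZMod 2] A :=
  Fintype.linearCombination (ZMod 2) φ ∘ₗ LinearMap.funLeft (ZMod 2) (ZMod 2) fun x => e.symm (x, ε)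

section Module

variable {A : Type*} [AddCommGroup A] [Module (ZMod 2) A] (φ : F → A) (ε : ZMod 2)
  (c : (Fin m → ZMod 2) → ZMod 2)

theorem halfSum_apply : halfSum e φ ε c = ∑ x, c (e.symm (x, ε)) • φ x := rfl

theorem halfSum_eq_sum_half : halfSum e φ ε c = ∑ x ∈ half e c ε, φ x := by
  rw [halfSum_apply, half, Finset.sum_filter]
  refine Finset.sum_congr rfl fun x _ => ?_
  rcases zmod_two_eq_zero_or_one (c (e.symm (x, ε))) with h | h <;> simp [h]

theorem halfSum_zero_add_halfSum_one :
    halfSum e φ 0 c + halfSum e φ 1 c = ∑ v, c v • φ (e v).1 := by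
  rw [← Equiv.sum_comp e.symm.toEquiv, Fintype.sum_prod_type_right, sum_zmod_two]
  simp [halfSum_apply]

theorem halfSum_one : halfSum e φ 1 c = ∑ v, c v • (e v).2 • φ (e v).1 := by
  rw [← Equiv.sum_comp e.symm.toEquiv, Fintype.sum_prod_type_right, sum_zmod_two]
  simp [halfSum_apply]

end Module

theorem even_card_half_iff (ε : ZMod 2) (c : (Fin m → ZMod 2) → ZMod 2) :
    Even (half e c ε).card ↔ halfSum e (fun _ => (1 : ZMod 2)) ε c = 0 := by
  rw [halfSum_eq_sum_half, Finset.sum_const, nsmul_eq_mul, mul_one, ZMod.natCast_eq_zero_iff_even]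

theorem hammingNorm_eq_card_half_add_card_half (c : (Fin m → ZMod 2) → ZMod 2) :
    hammingNorm c = (half e c 0).card + (half e c 1).card := by
  simp only [hammingNorm, half, Finset.card_filter, zmod_two_ne_zero_iff]
  rw [← Equiv.sum_comp e.symm.toEquiv, Fintype.sum_prod_type_right, sum_zmod_two]
  rfl

section Linear

variable {A κ : Type*} [CommRing A] [Algebra (ZMod 2) A] [Algebra (ZMod 2) F] [Fintype κ] {r : ℕ}
  {c : (Fin m → ZMod 2) → ZMod 2}

theorem halfSum_prod_zero_add_halfSum_prod_one_eq_zero (h : r + Fintype.card κ < m)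
    (hc : c ∈ reedMuller r m) (L : κ → F →ₗ[ZMod 2] A) :
    halfSum e (fun x => ∏ k, L k x) 0 c + halfSum e (fun x => ∏ k, L k x) 1 c = 0 := by
  rw [halfSum_zero_add_halfSum_one]
  exact sum_smul_prod_eq_zero h hc fun k =>
    L k ∘ₗ ((AddMonoidHom.fst F (ZMod 2)).comp e.toAddMonoidHom).toZModLinearMap 2

theorem halfSum_prod_eq_zero (h : r + Fintype.card κ + 1 < m) (hc : c ∈ reedMuller r m)
    (L : κ → F →ₗ[ZMod 2] A) (ε : ZMod 2) : halfSum e (fun x => ∏ k, L k x) ε c = 0 := by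
  have hone : halfSum e (fun x => ∏ k, L k x) 1 c = 0 := by
    have hsum := sum_smul_prod_eq_zero (κ := Option κ) (by rw [Fintype.card_option]; omega) hc
      fun k => k.elim (Algebra.linearMap (ZMod 2) A ∘ₗ
          ((AddMonoidHom.snd F (ZMod 2)).comp e.toAddMonoidHom).toZModLinearMap 2) fun k =>
        L k ∘ₗ ((AddMonoidHom.fst F (ZMod 2)).comp e.toAddMonoidHom).toZModLinearMap 2
    rw [halfSum_one, ← hsum]
    refine Finset.sum_congr rfl fun v _ => ?_
    rw [Fintype.prod_option, Algebra.smul_def (e v).2]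
    rfl
  rcases zmod_two_eq_zero_or_one ε with rfl | rfl
  · simpa only [hone, add_zero] using
      halfSum_prod_zero_add_halfSum_prod_one_eq_zero e (by omega) hc L
  · exact hone

end Linear

end HalfSum

section Goethals

variable {m k : ℕ} {F : Type*} [Field F] [Fintype F] [Algebra (ZMod 2) F]
  (e : (Fin m → ZMod 2) ≃+ F × ZMod 2) {c : (Fin m → ZMod 2) → ZMod 2}

/-- The moments which determine membership of a word `(X, Y)` in the Goethals code: cardinality
modulo two and sum of `X`, then the same for `Y`, then the sums over `X` and `Y` together of the
powers with exponents `2 ^ k + 1` and `2 ^ (k + 1) + 1`. -/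
def goethalsMoments (k : ℕ) : ((Fin m → ZMod 2) → ZMod 2) →ₗ[ZMod 2]
    (ZMod 2 × F) × (ZMod 2 × F × F × F) :=
  ((halfSum e (fun _ => 1) 0).prod (halfSum e (fun x => x) 0)).prod
    ((halfSum e (fun _ => 1) 1).prod ((halfSum e (fun x => x) 1).prod
      ((halfSum e (fun x => x ^ (2 ^ k + 1)) 0 + halfSum e (fun x => x ^ (2 ^ k + 1)) 1).prod
        (halfSum e (fun x => x ^ (2 ^ (k + 1) + 1)) 0
          + halfSum e (fun x => x ^ (2 ^ (k + 1) + 1)) 1))))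

/-- The moments of a Goethals codeword both of whose halves have the sum `S`. Nonlinearity of the
code is nonlinearity of this function of `S`. -/
def goethalsTarget (k : ℕ) (S : F) : (ZMod 2 × F) × (ZMod 2 × F × F × F) :=
  ((0, S), (0, S, S ^ (2 ^ k + 1), S ^ (2 ^ (k + 1) + 1)))

theorem goethalsMoments_apply (k : ℕ) (c : (Fin m → ZMod 2) → ZMod 2) :
    goethalsMoments e k c =
      ((halfSum e (fun _ => 1) 0 c, halfSum e (fun x => x) 0 c),
        (halfSum e (fun _ => 1) 1 c, halfSum e (fun x => x) 1 c,
          halfSum e (fun x => x ^ (2 ^ k + 1)) 0 c + halfSum e (fun x => x ^ (2 ^ k + 1)) 1 c,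
          halfSum e (fun x => x ^ (2 ^ (k + 1) + 1)) 0 c +
            halfSum e (fun x => x ^ (2 ^ (k + 1) + 1)) 1 c)) := rfl

theorem mem_goethals_iff (hm : m = 2 * k + 4) :
    c ∈ goethals e ↔ goethalsMoments e k c = goethalsTarget k (halfSum e (fun x => x) 0 c) := by
  have : CharP F 2 := charP_of_injective_algebraMap' (ZMod 2) 2
  have hk : m / 2 - 2 = k ∧ m / 2 - 1 = k + 1 := by omega
  have hswap : ∀ a b d : F, a + b = d ↔ a + d = b := fun a b d => by
    rw [eq_comm, ← sub_eq_iff_eq_add', CharTwo.sub_eq_add, add_comm d]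
  simp only [goethals, Set.mem_ofPred_eq, hk, even_card_half_iff, ← halfSum_eq_sum_half e,
    goethalsMoments_apply, goethalsTarget, Prod.mk.injEq, hswap]
  tauto

theorem goethalsMoments_surjective (hk : 1 ≤ k) (hF : Fintype.card F = 2 ^ (2 * k + 3)) :
    Function.Surjective (goethalsMoments e k) := by
  rintro ⟨⟨a, b⟩, a', b', u, v⟩
  obtain ⟨X, hX⟩ := powerMoments_surjective hk hF (a, b, 0, 0)
  obtain ⟨Y, hY⟩ := powerMoments_surjective hk hF (a', b', u, v)
  refine ⟨fun w => if (e w).2 = 0 then X (e w).1 else Y (e w).1, ?_⟩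
  simp only [powerMoments, Fintype.linearCombination_apply, Prod.ext_iff, Prod.fst_sum,
    Prod.snd_sum, Prod.smul_fst, Prod.smul_snd, smul_eq_mul, mul_one] at hX hY
  simp [goethalsMoments_apply, halfSum_apply, hX, hY]

theorem goethalsMoments_eq_zero {r : ℕ} (hr : r + 2 < m) (hc : c ∈ reedMuller r m) :
    goethalsMoments e k c = 0 := by
  have : CharP F 2 := charP_of_injective_algebraMap' (ZMod 2) 2
  have hcard : ∀ ε, halfSum e (fun _ => (1 : ZMod 2)) ε c = 0 := fun ε => by
    simpa using halfSum_prod_eq_zero e (κ := Fin 0) (A := ZMod 2) (by rw [Fintype.card_fin]; omega)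
      hc Fin.elim0 ε
  have hsum : ∀ ε, halfSum e (fun x => x) ε c = 0 := fun ε => by
    simpa using halfSum_prod_eq_zero e (κ := Fin 1) (by rw [Fintype.card_fin]; omega)
      hc ![LinearMap.id] ε
  have hpow : ∀ n, halfSum e (fun x => x ^ (2 ^ n + 1)) 0 c
      + halfSum e (fun x => x ^ (2 ^ n + 1)) 1 c = 0 := fun n => by
    simpa [pow_succ, iterateFrobenius_def] using
      halfSum_prod_zero_add_halfSum_prod_one_eq_zero e (κ := Fin 2) (by rwa [Fintype.card_fin]) hc
        ![(iterateFrobenius F 2 n).toAddMonoidHom.toZModLinearMap 2, LinearMap.id]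
  simp only [goethalsMoments_apply, hcard, hsum, hpow]
  rfl

theorem add_mem_goethals {r : ℕ} (hm : m = 2 * k + 4) (hr : r + 2 < m)
    {g : (Fin m → ZMod 2) → ZMod 2} (hc : c ∈ reedMuller r m) (hg : g ∈ goethals e) :
    c + g ∈ goethals e := by
  have hmoments := goethalsMoments_eq_zero e (k := k) hr hc
  have hsum : halfSum e (fun x => x) 0 c = 0 := congrArg (fun p => p.1.2) hmoments
  rw [mem_goethals_iff e hm] at hg ⊢
  rw [map_add, map_add, hmoments, hsum, zero_add, zero_add, hg]

theorem zero_mem_goethals (hm : m = 2 * k + 4) : 0 ∈ goethals e := by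
  rw [mem_goethals_iff e hm]
  simp [goethalsTarget, Prod.ext_iff]

theorem exists_mem_goethals (hm : m = 2 * k + 4) (hk : 1 ≤ k)
    (hF : Fintype.card F = 2 ^ (2 * k + 3)) (S : F) :
    ∃ g ∈ goethals e, halfSum e (fun x => x) 0 g = S := by
  obtain ⟨g, hg⟩ := goethalsMoments_surjective e hk hF (goethalsTarget k S)
  have hS : halfSum e (fun x => x) 0 g = S := congrArg (fun p => p.1.2) hg
  exact ⟨g, (mem_goethals_iff e hm).2 (by rw [hS, hg]), hS⟩

theorem exists_add_notMem_goethals (hm : m = 2 * k + 4) (hk : 1 ≤ k)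
    (hF : Fintype.card F = 2 ^ (2 * k + 3)) :
    ∃ g ∈ goethals e, ∃ g' ∈ goethals e, g + g' ∉ goethals e := by
  have : CharP F 2 := charP_of_injective_algebraMap' (ZMod 2) 2
  by_contra! hadd
  have hfix : ∀ x : F, x ^ 2 ^ k + x = 0 := by
    intro x
    obtain ⟨g, hg, hgS⟩ := exists_mem_goethals e hm hk hF 1
    obtain ⟨g', hg', hgS'⟩ := exists_mem_goethals e hm hk hF x
    have hgg' := hadd g hg g' hg'
    rw [mem_goethals_iff e hm] at hg hg' hgg'
    rw [map_add, map_add, hg, hg', hgS, hgS'] at hgg'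
    have hpow : (1 : F) ^ (2 ^ k + 1) + x ^ (2 ^ k + 1) = (1 + x) ^ (2 ^ k + 1) :=
      congrArg (fun p => p.2.2.2.1) hgg'
    rw [pow_succ (1 + x), add_pow_char_pow, one_pow, one_pow] at hpow
    linear_combination -hpow
  have hcoeff := eq_zero_of_forall_sum_mul_pow_eq_zero (n := ![2 ^ k, 1]) (c := ![(1 : F), 1])
    (by simp [Function.Injective, Fin.forall_fin_two, Nat.ne_of_gt hk, eq_comm (a := 1)])
    (Fin.forall_fin_two.2 ⟨by
      rw [hF]; exact Nat.pow_lt_pow_right one_lt_two (by omega), by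
      rw [hF]; exact Nat.one_lt_two_pow (by omega)⟩)
    fun x => by simpa using hfix x
  exact one_ne_zero (congrFun hcoeff 0)

theorem half_eq_empty_of_goethalsMoments_eq_sub (hF : Fintype.card F = 2 ^ (2 * k + 3)) {S S' : F}
    (hc : goethalsMoments e k c = goethalsTarget k S - goethalsTarget k S')
    (hcard : hammingNorm c < 8) : half e c 0 = ∅ ∧ half e c 1 = ∅ := by
  classical
  have : CharP F 2 := charP_of_injective_algebraMap' (ZMod 2) 2
  rw [hammingNorm_eq_card_half_add_card_half e] at hcard
  simp only [goethalsMoments_apply, goethalsTarget, Prod.mk_sub_mk, Prod.mk.injEq,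
    sub_self] at hc
  obtain ⟨⟨hX, hXsum⟩, hY, hYsum, hpow, hpow'⟩ := hc
  rw [← even_card_half_iff] at hX hY
  rw [halfSum_eq_sum_half] at hXsum hYsum
  rw [halfSum_eq_sum_half, halfSum_eq_sum_half] at hpow hpow'
  -- The translate of the first half by `S` and the second half form a Goethals pair.
  have hinj : Function.Injective fun x : F => 1 * (x + S) := fun x y h => by simpa using h
  have hsum : ∑ x ∈ (half e c 0).image fun x => 1 * (x + S), x = S - S' := by
    rw [Finset.sum_image hinj.injOn, ← Finset.mul_sum, Finset.sum_add_distrib, hXsum,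
      Finset.sum_const, nsmul_eq_mul, cast_card_eq_zero_of_even hX]
    ring
  have htranslate : ∀ n, ∑ x ∈ half e c 0, x ^ (2 ^ n + 1) + ∑ y ∈ half e c 1, y ^ (2 ^ n + 1) =
      S ^ (2 ^ n + 1) - S' ^ (2 ^ n + 1) →
      ∑ x ∈ (half e c 0).image fun x => 1 * (x + S), x ^ (2 ^ n + 1) +
        (∑ x ∈ (half e c 0).image fun x => 1 * (x + S), x) ^ (2 ^ n + 1) =
        ∑ y ∈ half e c 1, y ^ (2 ^ n + 1) := by
    intro n hn
    rw [hsum, Finset.sum_image hinj.injOn, sum_affine_pow_two_pow_add_one n hX, hXsum,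
      pow_succ (S - S'), sub_pow_char_pow]
    linear_combination hn + (- ∑ y ∈ half e c 1, y ^ (2 ^ n + 1) + S ^ (2 ^ n + 1) * 2 -
      S * S' ^ 2 ^ n - S ^ 2 ^ n * S') * CharTwo.two_eq_zero (R := F)
  have hpair := goethals_pair_eq_empty (fun x => by rw [← hF, FiniteField.pow_card])
    (by rwa [Finset.card_image_of_injective _ hinj]) hY
    (by rwa [Finset.card_image_of_injective _ hinj]) (hsum.trans hYsum.symm)
    (by rintro n (rfl | rfl); exacts [htranslate _ hpow, htranslate _ hpow'])
  rwa [Finset.image_eq_empty] at hpair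

theorem pairwise_goethals_eight_le_hammingDist (hm : m = 2 * k + 4)
    (hF : Fintype.card F = 2 ^ (2 * k + 3)) :
    (goethals e).Pairwise fun c c' => 8 ≤ hammingDist c c' := by
  intro c hc c' hc' hne
  by_contra! hlt
  rw [mem_goethals_iff e hm] at hc hc'
  rw [hammingDist_comm, hammingDist_eq_hammingNorm, neg_add_eq_sub] at hlt
  obtain ⟨h₀, h₁⟩ := half_eq_empty_of_goethalsMoments_eq_sub e hF
    (by rw [map_sub, hc, hc']) hlt
  have hnorm := hammingNorm_eq_card_half_add_card_half e (c - c')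
  rw [h₀, h₁, Finset.card_empty, hammingNorm_eq_zero] at hnorm
  exact hne (sub_eq_zero.1 hnorm)

end Goethals

/-! ### Cosets of binary codes -/

section Cosets

theorem card_preimage_mul_card {A B : Type*} [AddCommGroup A] [AddCommGroup B] {f : A →+ B}
    (hf : Function.Surjective f) (s : Set B) :
    Nat.card (f ⁻¹' s) * Nat.card B = Nat.card s * Nat.card A := by
  have card_preimage (s : Set B) : Nat.card (f ⁻¹' s) = Nat.card s * Nat.card f.ker := by
    let split : f ⁻¹' s ≃ s × f.ker :=
      { toFun := fun a => ⟨⟨f a, a.2⟩, ⟨a - Function.surjInv hf (f a), by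
          rw [AddMonoidHom.mem_ker, map_sub, Function.surjInv_eq hf, sub_self]⟩⟩
        invFun := fun p => ⟨p.2 + Function.surjInv hf p.1, by
          rw [Set.mem_preimage, map_add, p.2.2, zero_add, Function.surjInv_eq hf]
          exact p.1.2⟩
        left_inv := fun a => Subtype.ext (sub_add_cancel _ _)
        right_inv := fun ⟨b, c⟩ => by
          have hfb : f (c + Function.surjInv hf b) = b := by
            rw [map_add, c.2, zero_add, Function.surjInv_eq hf]
          ext <;> simp [hfb] }
    rw [Nat.card_congr split, Nat.card_prod]
  have card_univ := card_preimage Set.univ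
  rw [Set.preimage_univ, Nat.card_univ, Nat.card_univ] at card_univ
  rw [card_preimage s, card_univ]
  ring

variable {ι : Type*} {R : Submodule (ZMod 2) (ι → ZMod 2)} {G : Set (ι → ZMod 2)}

theorem IsCosetDecomposition.mem_iff {T : Finset (ι → ZMod 2)} (h : IsCosetDecomposition R G T)
    {v : ι → ZMod 2} : v ∈ G ↔ ∃ t ∈ T, v - t ∈ R := by
  rw [h.1]
  simp only [Set.mem_iUnion, Set.mem_ofPred_eq, exists_prop]
  refine exists_congr fun t => and_congr_right fun _ => ?_
  constructor
  · rintro ⟨c, hc, rfl⟩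
    simpa using hc
  · exact fun hv => ⟨v - t, hv, by simp⟩

theorem IsCosetDecomposition.eq_zero_of_sub_add_mem [Fintype ι] {T : Finset (ι → ZMod 2)}
    (hT : IsCosetDecomposition R G T) {d : ℕ}
    (hG : G.Pairwise fun c c' => d ≤ hammingDist c c') {t t' u : ι → ZMod 2} (ht : t ∈ T)
    (ht' : t' ∈ T) (hu : hammingNorm u < d) (hmem : t - (t' + u) ∈ R) : u = 0 := by
  have ht'G : t' ∈ G := hT.mem_iff.2 ⟨t', ht', by simp⟩
  have shift_mem : t' + u ∈ G := hT.mem_iff.2 ⟨t, ht, sub_mem_comm_iff.1 hmem⟩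
  by_contra hu₀
  have dist_ge : d ≤ hammingDist t' (t' + u) := hG ht'G shift_mem (by simpa using hu₀)
  rw [hammingDist_eq_hammingNorm, neg_add_cancel_left] at dist_ge
  exact hu.not_ge dist_ge

theorem isCosetDecomposition_self (C : Submodule (ZMod 2) (ι → ZMod 2)) :
    IsCosetDecomposition C (C : Set (ι → ZMod 2)) {0} := by
  refine ⟨?_, by simp⟩
  ext v
  simp

theorem IsCosetDecomposition.card {T : Finset (ι → ZMod 2)} (h : IsCosetDecomposition R G T) :
    Nat.card G = T.card * Nat.card R := by
  let f : T × R → G := fun p => ⟨p.2.1 + p.1.1, h.mem_iff.2 ⟨p.1.1, p.1.2, by simp⟩⟩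
  have injective : Function.Injective f := by
    rintro ⟨t, c⟩ ⟨t', c'⟩ heq
    have add_eq : c.1 + t.1 = c'.1 + t'.1 := congrArg Subtype.val heq
    have sub_eq : t.1 - t'.1 = c'.1 - c.1 := by
      rw [sub_eq_sub_iff_add_eq_add, add_comm, add_eq]
    obtain rfl : t = t' :=
      Subtype.ext (h.2 _ t.2 _ t'.2 (sub_eq ▸ R.sub_mem c'.2 c.2))
    exact Prod.ext rfl (Subtype.ext (add_right_cancel add_eq))
  have surjective : Function.Surjective f := by
    rintro ⟨v, hv⟩
    obtain ⟨t, ht, hvt⟩ := h.mem_iff.1 hv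
    exact ⟨(⟨t, ht⟩, ⟨v - t, hvt⟩), Subtype.ext (sub_add_cancel v t)⟩
  rw [← Nat.card_congr (Equiv.ofBijective f ⟨injective, surjective⟩), Nat.card_prod,
    Nat.card_eq_fintype_card, Fintype.card_coe]

theorem exists_isCosetDecomposition [Finite ι] (h : ∀ c ∈ R, ∀ g ∈ G, c + g ∈ G) :
    ∃ T, IsCosetDecomposition R G T := by
  classical
  let rep : (ι → ZMod 2) → (ι → ZMod 2) := fun g => (Submodule.Quotient.mk (p := R) g).out
  have sub_rep_mem : ∀ g, g - rep g ∈ R := fun g =>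
    (Submodule.Quotient.eq R).1 (Quotient.out_eq (Submodule.Quotient.mk (p := R) g)).symm
  have mem_image : ∀ t, t ∈ (Set.toFinite G).toFinset.image rep ↔ ∃ g ∈ G, rep g = t := by simp
  refine ⟨(Set.toFinite G).toFinset.image rep, ?_, ?_⟩
  · ext v
    simp only [Set.mem_iUnion, Set.mem_ofPred_eq, exists_prop]
    constructor
    · intro hv
      exact ⟨rep v, (mem_image _).2 ⟨v, hv, rfl⟩, v - rep v, sub_rep_mem v, by simp⟩
    · rintro ⟨t, ht, c, hc, rfl⟩
      obtain ⟨g, hg, rfl⟩ := (mem_image t).1 ht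
      convert h (c - (g - rep g)) (R.sub_mem hc (sub_rep_mem g)) g hg using 1
      abel
  · intro t ht t' ht' htt
    obtain ⟨g, _, rfl⟩ := (mem_image t).1 ht
    obtain ⟨g', _, rfl⟩ := (mem_image t').1 ht'
    have same_coset : g - g' ∈ R := by
      convert R.sub_mem (R.add_mem (sub_rep_mem g) htt) (sub_rep_mem g') using 1
      abel
    simp only [rep]
    rw [(Submodule.Quotient.eq R).2 same_coset]

end Cosets

/-! ### Pauli operators -/

section Pauli

variable {ι : Type*} [Fintype ι]

/-- The character `z ↦ (-1) ^ z` of `𝔽₂`, which gives the commutation signs of Pauli operators. -/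
def sgn : AddChar (ZMod 2) ℂ := AddChar.zmodChar 2 (ζ := -1) (by norm_num)

theorem sgn_one : sgn 1 = -1 := by
  rw [sgn, AddChar.zmodChar_apply, ZMod.val_one, pow_one]

theorem sgn_mul_self (z : ZMod 2) : sgn z * sgn z = 1 := by
  rw [← AddChar.map_add_eq_mul, CharTwo.add_self_eq_zero, AddChar.map_zero_eq_one]

theorem conj_sgn (z : ZMod 2) : (starRingEnd ℂ) (sgn z) = sgn z := by
  rcases zmod_two_eq_zero_or_one z with rfl | rfl <;> simp [sgn_one]

theorem sgn_sum {α : Type*} (s : Finset α) (f : α → ZMod 2) :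
    sgn (∑ i ∈ s, f i) = ∏ i ∈ s, sgn (f i) :=
  map_prod sgn.toMonoidHom (fun i => Multiplicative.ofAdd (f i)) s

theorem eq_add_iff_eq_add {V : Type*} [AddCommGroup V] [Module (ZMod 2) V] {x y a : V} :
    x = y + a ↔ y = x + a := by
  rw [← ZModModule.sub_eq_add y a, eq_sub_iff_add_eq, eq_comm]

theorem sigma_apply (α β x y : ZMod 2) :
    (sigmaX ^ α.val * sigmaZ ^ β.val) x y = if x = y + α then sgn (β * y) else 0 := by
  have one_add_one : (1 : ZMod 2) + 1 = 0 := by decide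
  have val_one : (1 : ZMod 2).val = 1 := rfl
  rcases zmod_two_eq_zero_or_one α with rfl | rfl <;>
    rcases zmod_two_eq_zero_or_one β with rfl | rfl <;>
    rcases zmod_two_eq_zero_or_one x with rfl | rfl <;>
    rcases zmod_two_eq_zero_or_one y with rfl | rfl <;>
    simp [val_one, one_add_one, sigmaX, sigmaZ, sgn_one, Matrix.mul_diagonal]

theorem pauli_apply (a b x y : ι → ZMod 2) :
    pauli a b x y = if x = y + a then sgn (b ⬝ᵥ y) else 0 := by
  simp only [pauli, Matrix.of_apply, sigma_apply]
  rw [Finset.prod_ite_zero, dotProduct, sgn_sum]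
  simp [funext_iff]

theorem pauli_zero_zero : pauli (0 : ι → ZMod 2) 0 = 1 := by
  ext x y
  rw [pauli_apply, Matrix.one_apply]
  simp

theorem eq_one_of_pauli_eq_smul_one {a b : ι → ZMod 2} {c : ℂ} (h : pauli a b = c • 1) :
    c = 1 := by
  have entry := congrFun (congrFun h a) 0
  rw [pauli_apply, zero_add, if_pos rfl, dotProduct_zero, AddChar.map_zero_eq_one,
    Matrix.smul_apply, Matrix.one_apply, smul_eq_mul, mul_ite, mul_one, mul_zero] at entry
  split_ifs at entry
  · exact entry.symm
  · exact absurd entry one_ne_zero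

variable [DecidableEq ι]

theorem pauli_mul (a b a' b' : ι → ZMod 2) :
    pauli a b * pauli a' b' = sgn (b ⬝ᵥ a') • pauli (a + a') (b + b') := by
  ext x y
  simp only [Matrix.mul_apply, pauli_apply, Matrix.smul_apply, smul_eq_mul, mul_ite, mul_zero]
  rw [Finset.sum_ite_eq' Finset.univ (y + a') fun z => (if x = z + a then sgn (b ⬝ᵥ z) else 0) * _,
    if_pos (Finset.mem_univ _), add_assoc y, add_comm a' a]
  split_ifs
  · rw [dotProduct_add, add_dotProduct, AddChar.map_add_eq_mul, AddChar.map_add_eq_mul]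
    ring
  · simp

theorem pauliOp_apply (a b : ι → ZMod 2) (ψ : Qubits ι) (x : ι → ZMod 2) :
    pauliOp a b ψ x = sgn (b ⬝ᵥ (x + a)) * ψ (x + a) := by
  simp only [pauliOp, Matrix.toLpLin_apply, Matrix.mulVec, dotProduct, pauli_apply, ite_mul,
    zero_mul, eq_add_iff_eq_add (x := x)]
  rw [Finset.sum_ite_eq' Finset.univ (x + a), if_pos (Finset.mem_univ _)]

theorem pauliOp_zero_zero (ψ : Qubits ι) : pauliOp 0 0 ψ = ψ := by
  ext x
  simp [pauliOp_apply]

theorem pauliOp_pauliOp (a b a' b' : ι → ZMod 2) (ψ : Qubits ι) :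
    pauliOp a b (pauliOp a' b' ψ) = sgn (b ⬝ᵥ a') • pauliOp (a + a') (b + b') ψ := by
  rw [pauliOp, pauliOp, ← LinearMap.comp_apply, ← Matrix.toLpLin_mul_same, pauli_mul, map_smul]
  rfl

theorem pauliOp_comm (a b a' b' : ι → ZMod 2) (ψ : Qubits ι) :
    pauliOp a b (pauliOp a' b' ψ) =
      (sgn (b ⬝ᵥ a') * sgn (b' ⬝ᵥ a)) • pauliOp a' b' (pauliOp a b ψ) := by
  rw [pauliOp_pauliOp, pauliOp_pauliOp, smul_smul, mul_assoc, sgn_mul_self, mul_one, add_comm a,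
    add_comm b]

theorem pauliOp_self (a b : ι → ZMod 2) (ψ : Qubits ι) :
    pauliOp a b (pauliOp a b ψ) = sgn (b ⬝ᵥ a) • ψ := by
  rw [pauliOp_pauliOp, ZModModule.add_self, ZModModule.add_self, pauliOp_zero_zero]

theorem pauliOp_injective (a b : ι → ZMod 2) : Function.Injective (pauliOp a b) := by
  intro φ ψ h
  have apply_twice := congrArg (fun χ => sgn (b ⬝ᵥ a) • pauliOp a b χ) h
  simpa [pauliOp_self, smul_smul, sgn_mul_self] using apply_twice

theorem inner_pauliOp_pauliOp (a b : ι → ZMod 2) (φ ψ : Qubits ι) :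
    inner ℂ (pauliOp a b φ) (pauliOp a b ψ) = inner ℂ φ ψ := by
  rw [PiLp.inner_apply, PiLp.inner_apply, ← Equiv.sum_comp (Equiv.addRight a) fun x =>
    inner ℂ (φ x) (ψ x)]
  refine Finset.sum_congr rfl fun x _ => ?_
  simp only [pauliOp_apply, RCLike.inner_apply, map_mul, conj_sgn, Equiv.coe_addRight]
  linear_combination ψ (x + a) * (starRingEnd ℂ) (φ (x + a)) * sgn_mul_self (b ⬝ᵥ (x + a))

end Pauli

/-! ### CSS codes and their translates -/

section Syndrome

variable {ι : Type*} [Fintype ι] [DecidableEq ι]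

/-- The joint eigenspace of the stabilizer generators `(a|0)`, `a ∈ C₂^⊥`, and `(0|b)`,
`b ∈ C₁^⊥`, of the CSS code of `C₁`, `C₂` for the signs by which they commute with the Pauli
operator `(t₁|t₂)`. -/
def syndromeSpace (C₁ C₂ : Submodule (ZMod 2) (ι → ZMod 2)) (t : (ι → ZMod 2) × (ι → ZMod 2)) :
    Submodule ℂ (Qubits ι) :=
  (⨅ a ∈ dual C₂, LinearMap.eqLocus (pauliOp a 0) (sgn (t.2 ⬝ᵥ a) • LinearMap.id)) ⊓
    ⨅ b ∈ dual C₁, LinearMap.eqLocus (pauliOp 0 b) (sgn (t.1 ⬝ᵥ b) • LinearMap.id)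

variable {C₁ C₂ : Submodule (ZMod 2) (ι → ZMod 2)} {t t' : (ι → ZMod 2) × (ι → ZMod 2)}
  {φ ψ : Qubits ι}

theorem mem_syndromeSpace :
    ψ ∈ syndromeSpace C₁ C₂ t ↔ (∀ a ∈ dual C₂, pauliOp a 0 ψ = sgn (t.2 ⬝ᵥ a) • ψ) ∧
      ∀ b ∈ dual C₁, pauliOp 0 b ψ = sgn (t.1 ⬝ᵥ b) • ψ := by
  simp [syndromeSpace, Submodule.mem_iInf]

theorem mem_cssCode :
    ψ ∈ cssCode C₁ C₂ ↔
      (∀ a ∈ dual C₂, pauliOp a 0 ψ = ψ) ∧ ∀ b ∈ dual C₁, pauliOp 0 b ψ = ψ := by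
  simp [cssCode, Submodule.mem_iInf]

theorem syndromeSpace_zero : syndromeSpace C₁ C₂ 0 = cssCode C₁ C₂ := by
  ext ψ
  simp [mem_syndromeSpace, mem_cssCode]

theorem pauliOp_mem_syndromeSpace (hψ : ψ ∈ syndromeSpace C₁ C₂ t) (a b : ι → ZMod 2) :
    pauliOp a b ψ ∈ syndromeSpace C₁ C₂ (t + (a, b)) := by
  rw [mem_syndromeSpace] at hψ ⊢
  refine ⟨fun d hd => ?_, fun d hd => ?_⟩
  · rw [pauliOp_comm, hψ.1 d hd, map_smul, smul_smul, zero_dotProduct, AddChar.map_zero_eq_one,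
      one_mul, ← AddChar.map_add_eq_mul, Prod.snd_add, add_dotProduct, add_comm]
  · rw [pauliOp_comm, hψ.2 d hd, map_smul, smul_smul, dotProduct_zero, AddChar.map_zero_eq_one,
      mul_one, ← AddChar.map_add_eq_mul, Prod.fst_add, add_dotProduct, add_comm,
      dotProduct_comm d]

theorem translate_cssCode (C₁ C₂ : Submodule (ZMod 2) (ι → ZMod 2))
    (t : (ι → ZMod 2) × (ι → ZMod 2)) :
    translate (cssCode C₁ C₂) t = syndromeSpace C₁ C₂ t := by
  rw [← syndromeSpace_zero]
  refine le_antisymm ?_ fun ψ hψ => ⟨sgn (t.2 ⬝ᵥ t.1) • pauliOp t.1 t.2 ψ, ?_, ?_⟩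
  · rintro _ ⟨ψ, hψ, rfl⟩
    simpa using pauliOp_mem_syndromeSpace hψ t.1 t.2
  · have shifted := pauliOp_mem_syndromeSpace hψ t.1 t.2
    rw [Prod.mk.eta, ZModModule.add_self] at shifted
    exact Submodule.smul_mem _ _ shifted
  · rw [map_smul, pauliOp_self, smul_smul, sgn_mul_self, one_smul]

theorem finrank_syndromeSpace (C₁ C₂ : Submodule (ZMod 2) (ι → ZMod 2))
    (t : (ι → ZMod 2) × (ι → ZMod 2)) :
    Module.finrank ℂ (syndromeSpace C₁ C₂ t) = Module.finrank ℂ (cssCode C₁ C₂) := by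
  rw [← translate_cssCode, translate]
  exact (Submodule.equivMapOfInjective _ (pauliOp_injective t.1 t.2) _).finrank_eq.symm

theorem unionCode_cssCode (C₁ C₂ : Submodule (ZMod 2) (ι → ZMod 2))
    (T : Finset ((ι → ZMod 2) × (ι → ZMod 2))) :
    unionCode (cssCode C₁ C₂) T = ⨆ t ∈ T, syndromeSpace C₁ C₂ t := by
  simp only [unionCode, translate_cssCode]

theorem syndromeSpace_le (h₁ : t.1 - t'.1 ∈ C₁) (h₂ : t.2 - t'.2 ∈ C₂) :
    syndromeSpace C₁ C₂ t ≤ syndromeSpace C₁ C₂ t' := by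
  have dotProduct_eq {C : Submodule (ZMod 2) (ι → ZMod 2)} {u u' : ι → ZMod 2}
      (h : u - u' ∈ C) {a : ι → ZMod 2} (ha : a ∈ dual C) : u ⬝ᵥ a = u' ⬝ᵥ a := by
    rw [← sub_eq_zero, ← sub_dotProduct, dotProduct_comm]
    exact ha _ h
  intro ψ hψ
  rw [mem_syndromeSpace] at hψ ⊢
  refine ⟨fun a ha => ?_, fun b hb => ?_⟩
  · rw [← dotProduct_eq h₂ ha, hψ.1 a ha]
  · rw [← dotProduct_eq h₁ hb, hψ.2 b hb]

theorem inner_eq_zero_of_pauliOp_eq_sgn_smul {a b : ι → ZMod 2} {z w : ZMod 2} (hzw : z ≠ w)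
    (hφ : pauliOp a b φ = sgn z • φ) (hψ : pauliOp a b ψ = sgn w • ψ) : inner ℂ φ ψ = 0 := by
  have add_eq_one : z + w = 1 :=
    zmod_two_ne_zero_iff.1 fun h => hzw (CharTwo.add_eq_zero.1 h)
  have inner_eq_neg := inner_pauliOp_pauliOp a b φ ψ
  rw [hφ, hψ, inner_smul_left, inner_smul_right, conj_sgn, ← mul_assoc,
    ← AddChar.map_add_eq_mul, add_eq_one, sgn_one] at inner_eq_neg
  linear_combination -inner_eq_neg / 2

theorem syndromeSpace_isOrtho (h : ¬ (t.1 - t'.1 ∈ C₁ ∧ t.2 - t'.2 ∈ C₂)) :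
    syndromeSpace C₁ C₂ t ⟂ syndromeSpace C₁ C₂ t' := by
  rw [Submodule.isOrtho_iff_inner_eq]
  intro φ hφ ψ hψ
  rw [mem_syndromeSpace] at hφ hψ
  rw [not_and_or] at h
  rcases h with h | h
  · obtain ⟨b, hb, hne⟩ := exists_mem_dual_dotProduct_ne h
    exact inner_eq_zero_of_pauliOp_eq_sgn_smul hne (hφ.2 b hb) (hψ.2 b hb)
  · obtain ⟨a, ha, hne⟩ := exists_mem_dual_dotProduct_ne h
    exact inner_eq_zero_of_pauliOp_eq_sgn_smul hne (hφ.1 a ha) (hψ.1 a ha)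

theorem mem_cssCode_iff_apply :
    ψ ∈ cssCode C₁ C₂ ↔ (∀ a ∈ dual C₂, ∀ x, ψ (x + a) = ψ x) ∧ ∀ x ∉ C₁, ψ x = 0 := by
  rw [mem_cssCode]
  refine and_congr (forall₂_congr fun a _ => ?_) ⟨fun h x hx => ?_, fun h b hb => ?_⟩
  · rw [PiLp.ext_iff]
    simp [pauliOp_apply]
  · obtain ⟨b, hb, hne⟩ := exists_mem_dual_dotProduct_ne (u' := 0) (by rwa [sub_zero])
    have apply_eq := congrArg (fun χ : Qubits ι => χ x) (h b hb)
    rw [zero_dotProduct, dotProduct_comm, zmod_two_ne_zero_iff] at hne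
    simp only [pauliOp_apply, add_zero, hne, sgn_one] at apply_eq
    linear_combination -apply_eq / 2
  · ext x
    rw [pauliOp_apply, add_zero]
    by_cases hx : x ∈ C₁
    · rw [hb x hx, AddChar.map_zero_eq_one, one_mul]
    · rw [h x hx, mul_zero]

end Syndrome

section CosetEncoding

variable {ι : Type*} [Fintype ι] {C D : Submodule (ZMod 2) (ι → ZMod 2)}

open scoped Classical in
/-- The encoding of the functions on `C / D` as the `D`-invariant states supported on `C`; for
`D = C₂^⊥` these form the CSS code of `C`, `C₂`. -/
def cosetEncoding (C D : Submodule (ZMod 2) (ι → ZMod 2)) :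
    ((C ⧸ D.comap C.subtype) → ℂ) →ₗ[ℂ] Qubits ι where
  toFun g := WithLp.toLp 2 fun x =>
    if h : x ∈ C then g (Submodule.Quotient.mk ⟨x, h⟩) else 0
  map_add' g g' := by
    ext x
    by_cases h : x ∈ C <;> simp [h]
  map_smul' c g := by
    ext x
    by_cases h : x ∈ C <;> simp [h]

theorem cosetEncoding_apply_coe (g : (C ⧸ D.comap C.subtype) → ℂ) (x : C) :
    cosetEncoding C D g x = g (Submodule.Quotient.mk x) := by
  simp [cosetEncoding]

theorem cosetEncoding_apply_of_notMem (g : (C ⧸ D.comap C.subtype) → ℂ) {x : ι → ZMod 2}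
    (hx : x ∉ C) : cosetEncoding C D g x = 0 := by
  simp [cosetEncoding, hx]

theorem cosetEncoding_single_apply_of_notMem [DecidableEq (C ⧸ D.comap C.subtype)]
    {x : ι → ZMod 2} (hx : x ∉ D) : cosetEncoding C D (Pi.single 0 1) x = 0 := by
  by_cases hxC : x ∈ C
  · rw [cosetEncoding_apply_coe _ ⟨x, hxC⟩, Pi.single_eq_of_ne]
    rwa [Ne, Submodule.Quotient.mk_eq_zero]
  · exact cosetEncoding_apply_of_notMem _ hxC

theorem cosetEncoding_injective : Function.Injective (cosetEncoding C D) := by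
  intro g g' h
  funext q
  obtain ⟨x, rfl⟩ := Submodule.Quotient.mk_surjective _ q
  rw [← cosetEncoding_apply_coe g x, h, cosetEncoding_apply_coe]

theorem cosetEncoding_apply_add (hD : D ≤ C) (g : (C ⧸ D.comap C.subtype) → ℂ)
    {a : ι → ZMod 2} (ha : a ∈ D) (x : ι → ZMod 2) :
    cosetEncoding C D g (x + a) = cosetEncoding C D g x := by
  by_cases hx : x ∈ C
  · have same_coset : (⟨x + a, C.add_mem hx (hD ha)⟩ : C) - ⟨x, hx⟩ ∈ D.comap C.subtype := by
      simpa using ha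
    rw [cosetEncoding_apply_coe g ⟨x, hx⟩, ← (Submodule.Quotient.eq _).2 same_coset]
    exact cosetEncoding_apply_coe g ⟨x + a, _⟩
  · have hxa : x + a ∉ C := fun h => hx ((C.add_mem_iff_left (hD ha)).1 h)
    rw [cosetEncoding_apply_of_notMem g hx, cosetEncoding_apply_of_notMem g hxa]

theorem mem_range_cosetEncoding (hD : D ≤ C) {ψ : Qubits ι} :
    ψ ∈ LinearMap.range (cosetEncoding C D) ↔
      (∀ a ∈ D, ∀ x, ψ (x + a) = ψ x) ∧ ∀ x ∉ C, ψ x = 0 := by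
  constructor
  · rintro ⟨g, rfl⟩
    exact ⟨fun a ha x => cosetEncoding_apply_add hD g ha x,
      fun x hx => cosetEncoding_apply_of_notMem g hx⟩
  · rintro ⟨invariant, supported⟩
    refine ⟨fun q => ψ q.out.1, ?_⟩
    ext x
    by_cases hx : x ∈ C
    · rw [cosetEncoding_apply_coe _ ⟨x, hx⟩]
      set y := (Submodule.Quotient.mk (p := D.comap C.subtype) ⟨x, hx⟩).out
      have same_coset : y - ⟨x, hx⟩ ∈ D.comap C.subtype :=
        (Submodule.Quotient.eq _).1 (Quotient.out_eq _)
      rw [← invariant _ same_coset x]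
      simp
    · rw [supported x hx, cosetEncoding_apply_of_notMem _ hx]

theorem finrank_range_cosetEncoding (hD : D ≤ C) :
    Module.finrank ℂ (LinearMap.range (cosetEncoding C D)) =
      2 ^ (Module.finrank (ZMod 2) C - Module.finrank (ZMod 2) D) := by
  classical
  have := Fintype.ofFinite (C ⧸ D.comap C.subtype)
  rw [LinearMap.finrank_range_of_inj cosetEncoding_injective, Module.finrank_fintype_fun_eq_card,
    Module.card_eq_pow_finrank (K := ZMod 2), ZMod.card, Submodule.finrank_quotient,
    (Submodule.comapSubtypeEquivOfLe hD).finrank_eq]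

end CosetEncoding

section CSS

variable {ι : Type*} [Fintype ι] [DecidableEq ι] {C₁ C₂ : Submodule (ZMod 2) (ι → ZMod 2)}

theorem range_cosetEncoding_dual (h : dual C₂ ≤ C₁) :
    LinearMap.range (cosetEncoding C₁ (dual C₂)) = cssCode C₁ C₂ :=
  Submodule.ext fun _ => (mem_range_cosetEncoding h).trans mem_cssCode_iff_apply.symm

theorem finrank_cssCode (h : dual C₂ ≤ C₁) :
    Module.finrank ℂ (cssCode C₁ C₂) =
      2 ^ (Module.finrank (ZMod 2) C₁ - Module.finrank (ZMod 2) (dual C₂)) := by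
  rw [← range_cosetEncoding_dual h, finrank_range_cosetEncoding h]

theorem not_detects_cssCode (h : dual C₂ ≤ C₁) {a : ι → ZMod 2} (ha : a ∈ C₁)
    (ha' : a ∉ dual C₂) : ¬ Detects (cssCode C₁ C₂) a 0 := by
  classical
  rintro ⟨c, hc⟩
  set ψ := cosetEncoding C₁ (dual C₂) (Pi.single 0 1) with hψ
  have ψ_mem : ψ ∈ cssCode C₁ C₂ := range_cosetEncoding_dual h ▸ LinearMap.mem_range_self _ _
  have flip_mem : pauliOp a 0 ψ ∈ cssCode C₁ C₂ := by
    rw [← syndromeSpace_zero] at ψ_mem ⊢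
    exact syndromeSpace_le (by simpa using ha) (by simp) (pauliOp_mem_syndromeSpace ψ_mem a 0)
  have orthogonal : inner ℂ (pauliOp a 0 ψ) ψ = (0 : ℂ) := by
    rw [PiLp.inner_apply]
    refine Finset.sum_eq_zero fun x _ => ?_
    by_cases hx : x ∈ dual C₂
    · have flip_notMem : x + a ∉ dual C₂ := fun hxa =>
        ha' (((dual C₂).add_mem_iff_right hx).1 hxa)
      rw [pauliOp_apply, hψ, cosetEncoding_single_apply_of_notMem flip_notMem, mul_zero,
        inner_zero_left]
    · rw [hψ, cosetEncoding_single_apply_of_notMem hx, inner_zero_right]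
  have norm_eq_zero := hc _ flip_mem _ ψ_mem
  rw [orthogonal, mul_zero, inner_pauliOp_pauliOp, inner_self_eq_zero, hψ,
    map_eq_zero_iff _ cosetEncoding_injective, Pi.single_eq_zero_iff] at norm_eq_zero
  exact one_ne_zero norm_eq_zero

theorem pauli_mul_of_mem_dual (h : dual C₂ ≤ C₁) {b a' : ι → ZMod 2} (hb : b ∈ dual C₁)
    (ha' : a' ∈ dual C₂) (a b' : ι → ZMod 2) :
    pauli a b * pauli a' b' = pauli (a + a') (b + b') := by
  rw [pauli_mul, hb a' (h ha'), AddChar.map_zero_eq_one, one_smul]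

theorem pauli_mul_self_of_mem_dual (h : dual C₂ ≤ C₁) {a b : ι → ZMod 2} (ha : a ∈ dual C₂)
    (hb : b ∈ dual C₁) : pauli a b * pauli a b = 1 := by
  rw [pauli_mul_of_mem_dual h hb ha, ZModModule.add_self, ZModModule.add_self, pauli_zero_zero]

/-- The stabilizer group of the CSS code of `C₁`, `C₂`. -/
def cssStabilizer (h : dual C₂ ≤ C₁) : Subgroup (Matrix (ι → ZMod 2) (ι → ZMod 2) ℂ)ˣ where
  carrier := {g | ∃ a ∈ dual C₂, ∃ b ∈ dual C₁, g.val = pauli a b}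
  one_mem' := ⟨0, (dual C₂).zero_mem, 0, (dual C₁).zero_mem, pauli_zero_zero.symm⟩
  mul_mem' := by
    rintro g g' ⟨a, ha, b, hb, hg⟩ ⟨a', ha', b', hb', hg'⟩
    refine ⟨a + a', (dual C₂).add_mem ha ha', b + b', (dual C₁).add_mem hb hb', ?_⟩
    rw [Units.val_mul, hg, hg', pauli_mul_of_mem_dual h hb ha']
  inv_mem' := by
    rintro g ⟨a, ha, b, hb, hg⟩
    have inv_eq_self : g⁻¹ = g := inv_eq_of_mul_eq_one_left <| Units.ext <| by
      rw [Units.val_mul, hg, pauli_mul_self_of_mem_dual h ha hb, Units.val_one]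
    exact ⟨a, ha, b, hb, by rw [inv_eq_self, hg]⟩

theorem exists_mem_cssStabilizer (h : dual C₂ ≤ C₁) {a b : ι → ZMod 2} (ha : a ∈ dual C₂)
    (hb : b ∈ dual C₁) : ∃ g ∈ cssStabilizer h, g.val = pauli a b :=
  have mul_self := pauli_mul_self_of_mem_dual h ha hb
  ⟨⟨pauli a b, pauli a b, mul_self, mul_self⟩, ⟨a, ha, b, hb, rfl⟩, rfl⟩

theorem mem_cssCode_iff_forall_mem_cssStabilizer (h : dual C₂ ≤ C₁) {ψ : Qubits ι} :
    ψ ∈ cssCode C₁ C₂ ↔ ∀ g ∈ cssStabilizer h, Matrix.toEuclideanLin g.val ψ = ψ := by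
  rw [mem_cssCode]
  constructor
  · rintro ⟨fix_x, fix_z⟩ g ⟨a, ha, b, hb, hg⟩
    have pauliOp_eq := pauliOp_pauliOp a 0 0 b ψ
    rw [fix_z b hb, fix_x a ha, zero_dotProduct, AddChar.map_zero_eq_one, one_smul, add_zero,
      zero_add] at pauliOp_eq
    rw [hg]
    exact pauliOp_eq.symm
  · intro fixed
    have pauliOp_eq {a b : ι → ZMod 2} (ha : a ∈ dual C₂) (hb : b ∈ dual C₁) :
        pauliOp a b ψ = ψ := by
      obtain ⟨g, hg, hgab⟩ := exists_mem_cssStabilizer h ha hb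
      rw [pauliOp, ← hgab, fixed g hg]
    exact ⟨fun a ha => pauliOp_eq ha (zero_mem _), fun b hb => pauliOp_eq (zero_mem _) hb⟩

theorem isStabilizerCode_cssCode (h : dual C₂ ≤ C₁) : IsStabilizerCode (cssCode C₁ C₂) := by
  refine ⟨cssStabilizer h, ?_, ?_, ?_, fun _ => mem_cssCode_iff_forall_mem_cssStabilizer h⟩
  · rintro g ⟨a, -, b, -, hg⟩
    exact ⟨0, a, b, by rw [hg, pow_zero, one_smul]⟩
  · rintro g ⟨a, ha, b, hb, hg⟩ g' ⟨a', ha', b', hb', hg'⟩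
    refine Units.ext ?_
    rw [Units.val_mul, Units.val_mul, hg, hg', pauli_mul_of_mem_dual h hb ha',
      pauli_mul_of_mem_dual h hb' ha, add_comm a, add_comm b]
  · rintro g ⟨a, -, b, -, hg⟩ c hc
    exact eq_one_of_pauli_eq_smul_one (hg.symm.trans hc)

end CSS

/-! ### Union codes -/

theorem finrank_biSup_of_isOrtho {𝕜 E α : Type*} [RCLike 𝕜] [NormedAddCommGroup E]
    [InnerProductSpace 𝕜 E] [FiniteDimensional 𝕜 E] {V : α → Submodule 𝕜 E} {T : Finset α}
    (h : (T : Set α).Pairwise fun t t' => V t ⟂ V t') :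
    Module.finrank 𝕜 (⨆ t ∈ T, V t : Submodule 𝕜 E) = ∑ t ∈ T, Module.finrank 𝕜 (V t) := by
  classical
  induction T using Finset.induction_on with
  | empty => simp
  | insert a s ha ih =>
    have orthogonal : V a ⟂ ⨆ t ∈ s, V t := by
      simp only [Submodule.isOrtho_iSup_right]
      exact fun t ht => h (Finset.mem_insert_self a s) (Finset.mem_insert_of_mem ht)
        (ne_of_mem_of_not_mem ht ha).symm
    rw [Finset.iSup_insert, Finset.sum_insert ha,
      ← ih (h.mono (Finset.coe_subset.2 (Finset.subset_insert a s))),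
      ← Submodule.finrank_sup_add_finrank_inf_eq, orthogonal.disjoint.eq_bot, finrank_bot,
      add_zero]

section Detection

variable {ι : Type*} [Fintype ι]

theorem hammingNorm_le_pauliWeight_left (a b : ι → ZMod 2) :
    hammingNorm a ≤ pauliWeight a b :=
  Finset.card_le_card (Finset.monotone_filter_right _ fun _ _ => Or.inl)

theorem hammingNorm_le_pauliWeight_right (a b : ι → ZMod 2) :
    hammingNorm b ≤ pauliWeight a b :=
  Finset.card_le_card (Finset.monotone_filter_right _ fun _ _ => Or.inr)

theorem pauliWeight_zero_right (a : ι → ZMod 2) : pauliWeight a 0 = hammingNorm a := by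
  simp [pauliWeight, hammingNorm]

variable [DecidableEq ι]

theorem Detects.mono {Q Q' : Submodule ℂ (Qubits ι)} (h : Q ≤ Q') {a b : ι → ZMod 2}
    (detects : Detects Q' a b) : Detects Q a b :=
  let ⟨c, hc⟩ := detects
  ⟨c, fun φ hφ ψ hψ => hc φ (h hφ) ψ (h hψ)⟩

theorem detects_zero (Q : Submodule ℂ (Qubits ι)) : Detects Q 0 0 :=
  ⟨1, fun φ _ ψ _ => by rw [pauliOp_zero_zero, one_mul]⟩

theorem detects_unionCode_cssCode {C₁ C₂ : Submodule (ZMod 2) (ι → ZMod 2)}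
    {T : Finset ((ι → ZMod 2) × (ι → ZMod 2))} {a b : ι → ZMod 2}
    (h : ∀ t ∈ T, ∀ t' ∈ T, ¬ (t.1 - (t'.1 + a) ∈ C₁ ∧ t.2 - (t'.2 + b) ∈ C₂)) :
    Detects (unionCode (cssCode C₁ C₂) T) a b := by
  rw [unionCode_cssCode]
  have orthogonal : (⨆ t ∈ T, syndromeSpace C₁ C₂ t) ⟂
      (⨆ t ∈ T, syndromeSpace C₁ C₂ t).map (pauliOp a b) := by
    simp only [Submodule.map_iSup, Submodule.isOrtho_iSup_left, Submodule.isOrtho_iSup_right]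
    intro t' ht' t ht
    refine (syndromeSpace_isOrtho (t' := t' + (a, b)) (h t ht t' ht')).mono_right ?_
    rintro _ ⟨ψ, hψ, rfl⟩
    exact pauliOp_mem_syndromeSpace hψ a b
  refine ⟨0, fun φ hφ ψ hψ => ?_⟩
  rw [zero_mul]
  exact Submodule.isOrtho_iff_inner_eq.1 orthogonal φ hφ _ (Submodule.mem_map_of_mem hψ)

theorem IsStabilizerCode.pauliOp_pauliOp_mem {Q : Submodule ℂ (Qubits ι)}
    (hQ : IsStabilizerCode Q) {ψ : Qubits ι} {t u t' u' : ι → ZMod 2} (hψ : ψ ∈ Q)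
    (h : pauliOp t u ψ ∈ Q) (h' : pauliOp t' u' ψ ∈ Q) :
    pauliOp t' u' (pauliOp t u ψ) ∈ Q := by
  obtain ⟨S, isPauli, -, -, mem_iff⟩ := hQ
  rw [mem_iff] at hψ h h' ⊢
  intro g hg
  obtain ⟨k, a, b, hgab⟩ := isPauli g hg
  set ε := sgn (b ⬝ᵥ t') * sgn (u' ⬝ᵥ a)
  have commute (χ : Qubits ι) : Matrix.toEuclideanLin g.val (pauliOp t' u' χ) =
      ε • pauliOp t' u' (Matrix.toEuclideanLin g.val χ) := by
    rw [hgab, map_smul, LinearMap.smul_apply, LinearMap.smul_apply, map_smul, smul_comm ε]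
    exact congrArg _ (pauliOp_comm a b t' u' χ)
  have smul_eq : ε • pauliOp t' u' ψ = pauliOp t' u' ψ := by
    have eigen := commute ψ
    rwa [h' g hg, hψ g hg, eq_comm] at eigen
  rw [commute, h g hg, pauliOp_comm, smul_comm, ← map_smul, smul_eq]

end Detection

section CSSUnion

variable {ι : Type*} [Fintype ι] [DecidableEq ι] {C₁ C₂ : Submodule (ZMod 2) (ι → ZMod 2)}
  {G₁ G₂ : Set (ι → ZMod 2)} {T₁ T₂ : Finset (ι → ZMod 2)}

theorem pauliOp_mem_cssUnionCode_iff (hT₁ : IsCosetDecomposition C₁ G₁ T₁)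
    (hT₂ : IsCosetDecomposition C₂ G₂ T₂) {ψ : Qubits ι} (hψ : ψ ∈ cssCode C₁ C₂) (hψ₀ : ψ ≠ 0)
    {u v : ι → ZMod 2} :
    pauliOp u v ψ ∈ cssUnionCode C₁ C₂ T₁ T₂ ↔ u ∈ G₁ ∧ v ∈ G₂ := by
  rw [← syndromeSpace_zero] at hψ
  have mem_syndrome := pauliOp_mem_syndromeSpace hψ u v
  rw [zero_add] at mem_syndrome
  rw [cssUnionCode, unionCode_cssCode, hT₁.mem_iff, hT₂.mem_iff]
  constructor
  · intro mem_union
    by_contra notMem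
    have orthogonal : syndromeSpace C₁ C₂ (u, v) ⟂ ⨆ t ∈ T₁ ×ˢ T₂, syndromeSpace C₁ C₂ t := by
      simp only [Submodule.isOrtho_iSup_right, Finset.mem_product]
      exact fun t ht => syndromeSpace_isOrtho fun h =>
        notMem ⟨⟨t.1, ht.1, h.1⟩, ⟨t.2, ht.2, h.2⟩⟩
    have eq_zero := Submodule.isOrtho_iff_inner_eq.1 orthogonal _ mem_syndrome _ mem_union
    rw [inner_self_eq_zero, map_eq_zero_iff _ (pauliOp_injective u v)] at eq_zero
    exact hψ₀ eq_zero
  · rintro ⟨⟨t₁, ht₁, hu⟩, ⟨t₂, ht₂, hv⟩⟩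
    exact Submodule.mem_iSup_of_mem (t₁, t₂) (Submodule.mem_iSup_of_mem
      (Finset.mk_mem_product ht₁ ht₂) (syndromeSpace_le hu hv mem_syndrome))

theorem cssCode_le_cssUnionCode (hT₁ : IsCosetDecomposition C₁ G₁ T₁)
    (hT₂ : IsCosetDecomposition C₂ G₂ T₂) (h₁ : 0 ∈ G₁) (h₂ : 0 ∈ G₂) :
    cssCode C₁ C₂ ≤ cssUnionCode C₁ C₂ T₁ T₂ := by
  intro ψ hψ
  rcases eq_or_ne ψ 0 with rfl | hψ₀
  · exact zero_mem _
  · rw [← pauliOp_zero_zero ψ]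
    exact (pauliOp_mem_cssUnionCode_iff hT₁ hT₂ hψ hψ₀).2 ⟨h₁, h₂⟩

theorem pairwise_isOrtho_translate_cssCode (hT₁ : IsCosetDecomposition C₁ G₁ T₁)
    (hT₂ : IsCosetDecomposition C₂ G₂ T₂) :
    ((T₁ ×ˢ T₂ : Finset _) : Set ((ι → ZMod 2) × (ι → ZMod 2))).Pairwise fun t t' =>
      translate (cssCode C₁ C₂) t ⟂ translate (cssCode C₁ C₂) t' := by
  intro t ht t' ht' hne
  rw [Finset.mem_coe, Finset.mem_product] at ht ht'
  rw [translate_cssCode, translate_cssCode]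
  exact syndromeSpace_isOrtho fun h =>
    hne (Prod.ext (hT₁.2 _ ht.1 _ ht'.1 h.1) (hT₂.2 _ ht.2 _ ht'.2 h.2))

theorem finrank_cssUnionCode (hT₁ : IsCosetDecomposition C₁ G₁ T₁)
    (hT₂ : IsCosetDecomposition C₂ G₂ T₂) :
    Module.finrank ℂ (cssUnionCode C₁ C₂ T₁ T₂) =
      T₁.card * T₂.card * Module.finrank ℂ (cssCode C₁ C₂) := by
  have finrank_translate (t : (ι → ZMod 2) × (ι → ZMod 2)) :
      Module.finrank ℂ (translate (cssCode C₁ C₂) t) = Module.finrank ℂ (cssCode C₁ C₂) := by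
    rw [translate_cssCode, finrank_syndromeSpace]
  rw [cssUnionCode, unionCode,
    finrank_biSup_of_isOrtho (pairwise_isOrtho_translate_cssCode hT₁ hT₂),
    Finset.sum_congr rfl fun t _ => finrank_translate t, Finset.sum_const, Finset.card_product,
    smul_eq_mul]

theorem detects_cssUnionCode (hT₁ : IsCosetDecomposition C₁ G₁ T₁)
    (hT₂ : IsCosetDecomposition C₂ G₂ T₂) {d : ℕ}
    (hG₁ : G₁.Pairwise fun c c' => d ≤ hammingDist c c')
    (hG₂ : G₂.Pairwise fun c c' => d ≤ hammingDist c c') {a b : ι → ZMod 2}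
    (hab : pauliWeight a b < d) : Detects (cssUnionCode C₁ C₂ T₁ T₂) a b := by
  by_cases trivial_error : a = 0 ∧ b = 0
  · rw [trivial_error.1, trivial_error.2]
    exact detects_zero _
  · refine detects_unionCode_cssCode fun t ht t' ht' hmem => trivial_error ⟨?_, ?_⟩
    all_goals rw [Finset.mem_product] at ht ht'
    · exact hT₁.eq_zero_of_sub_add_mem hG₁ ht.1 ht'.1
        ((hammingNorm_le_pauliWeight_left a b).trans_lt hab) hmem.1
    · exact hT₂.eq_zero_of_sub_add_mem hG₂ ht.2 ht'.2
        ((hammingNorm_le_pauliWeight_right a b).trans_lt hab) hmem.2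

theorem hasMinDistance_cssUnionCode (h : dual C₂ ≤ C₁) (hT₁ : IsCosetDecomposition C₁ G₁ T₁)
    (hT₂ : IsCosetDecomposition C₂ G₂ T₂) (h₁ : 0 ∈ G₁) (h₂ : 0 ∈ G₂) {a : ι → ZMod 2}
    (ha : a ∈ C₁) (ha' : a ∉ dual C₂)
    (hG₁ : G₁.Pairwise fun c c' => hammingNorm a ≤ hammingDist c c')
    (hG₂ : G₂.Pairwise fun c c' => hammingNorm a ≤ hammingDist c c') :
    HasMinDistance (cssUnionCode C₁ C₂ T₁ T₂) (hammingNorm a) := by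
  refine ⟨⟨a, 0, fun detects => ?_, pauliWeight_zero_right a⟩, ?_⟩
  · exact not_detects_cssCode h ha ha' (detects.mono (cssCode_le_cssUnionCode hT₁ hT₂ h₁ h₂))
  · rintro w ⟨b, c, not_detects, rfl⟩
    by_contra! hlt
    exact not_detects (detects_cssUnionCode hT₁ hT₂ hG₁ hG₂ hlt)

theorem cssUnionCode_zero_zero (C₁ C₂ : Submodule (ZMod 2) (ι → ZMod 2)) :
    cssUnionCode C₁ C₂ {0} {0} = cssCode C₁ C₂ := by
  rw [cssUnionCode, unionCode_cssCode, ← syndromeSpace_zero]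
  simp [Prod.mk_zero_zero]

theorem hasMinDistance_cssCode (h : dual C₂ ≤ C₁) {a : ι → ZMod 2} (ha : a ∈ C₁)
    (ha' : a ∉ dual C₂)
    (hC₁ : (C₁ : Set (ι → ZMod 2)).Pairwise fun c c' => hammingNorm a ≤ hammingDist c c')
    (hC₂ : (C₂ : Set (ι → ZMod 2)).Pairwise fun c c' => hammingNorm a ≤ hammingDist c c') :
    HasMinDistance (cssCode C₁ C₂) (hammingNorm a) :=
  cssUnionCode_zero_zero C₁ C₂ ▸ hasMinDistance_cssUnionCode h (isCosetDecomposition_self C₁)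
    (isCosetDecomposition_self C₂) C₁.zero_mem C₂.zero_mem ha ha' hC₁ hC₂

theorem cssCode_ne_bot (h : dual C₂ ≤ C₁) : cssCode C₁ C₂ ≠ ⊥ := by
  rw [← Submodule.one_le_finrank_iff, finrank_cssCode h]
  exact Nat.one_le_two_pow

theorem not_isStabilizerCode_cssUnionCode (h : dual C₂ ≤ C₁)
    (hT₁ : IsCosetDecomposition C₁ G₁ T₁) (hT₂ : IsCosetDecomposition C₂ G₂ T₂) (h₁ : 0 ∈ G₁)
    (h₂ : 0 ∈ G₂) {g g' : ι → ZMod 2} (hg : g ∈ G₁) (hg' : g' ∈ G₁) (hadd : g + g' ∉ G₁) :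
    ¬ IsStabilizerCode (cssUnionCode C₁ C₂ T₁ T₂) := by
  intro stabilizer
  obtain ⟨ψ, hψ, hψ₀⟩ := (cssCode C₁ C₂).exists_mem_ne_zero_of_ne_bot (cssCode_ne_bot h)
  have mem_iff (u : ι → ZMod 2) : pauliOp u 0 ψ ∈ cssUnionCode C₁ C₂ T₁ T₂ ↔ u ∈ G₁ :=
    (pauliOp_mem_cssUnionCode_iff hT₁ hT₂ hψ hψ₀).trans (and_iff_left h₂)
  have mem_union := cssCode_le_cssUnionCode hT₁ hT₂ h₁ h₂ hψ
  have product_mem :=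
    stabilizer.pauliOp_pauliOp_mem mem_union ((mem_iff g').2 hg') ((mem_iff g).2 hg)
  rw [pauliOp_pauliOp, zero_dotProduct, AddChar.map_zero_eq_one, one_smul, add_zero,
    mem_iff] at product_mem
  exact hadd product_mem

end CSSUnion

/-! ### Parameters -/

section Parameters

variable {m : ℕ}

theorem two_mul_le_choose_two (hm : 5 ≤ m) : 2 * m ≤ m.choose 2 := by
  obtain ⟨n, rfl⟩ := Nat.exists_eq_add_of_le' hm
  rw [Nat.choose_two_right, Nat.le_div_iff_mul_le two_pos, Nat.add_sub_assoc (by norm_num)]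
  nlinarith

theorem dual_reedMuller_sub_three (hm : 3 ≤ m) : dual (reedMuller (m - 3) m) = reedMuller 2 m :=
  dual_reedMuller (by omega)

theorem dual_reedMuller_sub_three_le (hm : 5 ≤ m) :
    dual (reedMuller (m - 3) m) ≤ reedMuller (m - 3) m := by
  rw [dual_reedMuller_sub_three (by omega)]
  exact reedMuller_mono (by omega)

theorem finrank_dual_reedMuller_sub_three (hm : 3 ≤ m) :
    Module.finrank (ZMod 2) (dual (reedMuller (m - 3) m)) = 1 + m + m.choose 2 := by
  rw [dual_reedMuller_sub_three hm, finrank_reedMuller]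
  simp [Finset.sum_range_succ]

theorem card_words (m : ℕ) : Fintype.card (Fin m → ZMod 2) = 2 ^ m := by
  rw [Fintype.card_fun, ZMod.card, Fintype.card_fin]

theorem finrank_reedMuller_sub_three (hm : 3 ≤ m) :
    Module.finrank (ZMod 2) (reedMuller (m - 3) m) + (1 + m + m.choose 2) = 2 ^ m := by
  rw [← finrank_dual_reedMuller_sub_three hm, add_comm, finrank_dual_add_finrank, card_words]

theorem exists_mem_reedMuller_hammingNorm_eq_eight (hm : 6 ≤ m) :
    ∃ a ∈ reedMuller (m - 3) m, a ∉ dual (reedMuller (m - 3) m) ∧ hammingNorm a = 8 := by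
  obtain ⟨S, -, hS⟩ := Finset.exists_subset_card_eq
    (show m - 3 ≤ (Finset.univ : Finset (Fin m)).card by simp)
  have compl_card_le : Sᶜ.card ≤ m - 3 := by
    rw [Finset.card_compl, Fintype.card_fin, hS]
    omega
  refine ⟨monomialWord S, monomialWord_mem_reedMuller hS.le, fun mem_dual => ?_, ?_⟩
  · have product_eq_zero := mem_dual _ (monomialWord_mem_reedMuller compl_card_le)
    rw [dotProduct_monomialWord_compl] at product_eq_zero
    exact one_ne_zero product_eq_zero
  · rw [hammingNorm_monomialWord, hS, Nat.sub_sub_self (by omega)]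
    norm_num

theorem finrank_cssCode_reedMuller (hm : 5 ≤ m) :
    Module.finrank ℂ (cssCode (reedMuller (m - 3) m) (reedMuller (m - 3) m)) =
      2 ^ (2 ^ m - 2 * m.choose 2 - 2 * m - 2) := by
  have finrank_add := finrank_reedMuller_sub_three (m := m) (by omega)
  rw [finrank_cssCode (dual_reedMuller_sub_three_le hm),
    finrank_dual_reedMuller_sub_three (by omega)]
  congr 1
  omega

theorem isCode_cssCode_reedMuller (hm : 6 ≤ m) :
    IsCode (cssCode (reedMuller (m - 3) m) (reedMuller (m - 3) m))
      (2 ^ m) (2 ^ (2 ^ m - 2 * m.choose 2 - 2 * m - 2)) 8 := by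
  have hm5 : 5 ≤ m := by omega
  obtain ⟨a, ha, ha', weight_eq⟩ := exists_mem_reedMuller_hammingNorm_eq_eight hm
  have dist_ge := pairwise_reedMuller_two_pow_le_hammingDist (m - 3) m
  rw [Nat.sub_sub_self (by omega), show 2 ^ 3 = hammingNorm a from weight_eq.symm] at dist_ge
  exact ⟨card_words m, finrank_cssCode_reedMuller hm5,
    weight_eq ▸ hasMinDistance_cssCode (dual_reedMuller_sub_three_le hm5) ha ha' dist_ge dist_ge⟩

section Goethals

variable {k : ℕ} {F : Type*} [Field F] [Fintype F] [Algebra (ZMod 2) F]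
  (e : (Fin m → ZMod 2) ≃+ F × ZMod 2)

theorem card_goethals (hm : m = 2 * k + 4) (hk : 1 ≤ k)
    (hF : Fintype.card F = 2 ^ (2 * k + 3)) :
    Nat.card (goethals e) * 2 ^ (4 * (2 * k + 3) + 2) = 2 ^ (2 * k + 3 + 2 ^ m) := by
  have injective : Function.Injective (goethalsTarget k : F → _) := fun _ _ h =>
    congrArg (fun p => p.1.2) h
  have preimage_range :
      (goethalsMoments e k).toAddMonoidHom ⁻¹' Set.range (goethalsTarget k) = goethals e := by
    ext c
    rw [mem_goethals_iff e hm, Set.mem_preimage, Set.mem_range, LinearMap.toAddMonoidHom_coe]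
    constructor
    · rintro ⟨S, hS⟩
      obtain rfl : S = halfSum e (fun x => x) 0 c := congrArg (fun p => p.1.2) hS
      exact hS.symm
    · exact fun h => ⟨_, h.symm⟩
  have card_mul := card_preimage_mul_card (f := (goethalsMoments e k).toAddMonoidHom)
    (goethalsMoments_surjective e hk hF) (Set.range (goethalsTarget k))
  rw [preimage_range, Nat.card_range_of_injective injective] at card_mul
  simp only [Nat.card_eq_fintype_card (α := F), Nat.card_prod, Nat.card_fun, Nat.card_zmod, hF,
    Nat.card_eq_fintype_card (α := Fin m), Fintype.card_fin] at card_mul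
  rw [pow_add 2 (2 * k + 3), ← card_mul]
  ring

theorem IsCosetDecomposition.card_goethals (hm : m = 2 * k + 4) (hk : 1 ≤ k)
    (hF : Fintype.card F = 2 ^ (2 * k + 3)) {T : Finset ((Fin m → ZMod 2) → ZMod 2)}
    (hT : IsCosetDecomposition (reedMuller (m - 3) m) (goethals e) T) :
    T.card = 2 ^ (m.choose 2 - 2 * m + 2) := by
  have card_mul := QCode.card_goethals e hm hk hF
  have finrank_add := finrank_reedMuller_sub_three (m := m) (by omega)
  have choose_ge := two_mul_le_choose_two (m := m) (by omega)
  have exponent_eq : 2 * k + 3 + 2 ^ m = m.choose 2 - 2 * m + 2 +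
      (Module.finrank (ZMod 2) (reedMuller (m - 3) m) + (4 * (2 * k + 3) + 2)) := by omega
  rw [hT.card, Module.natCard_eq_pow_finrank (K := ZMod 2), Nat.card_zmod, mul_assoc, ← pow_add,
    exponent_eq, pow_add 2 (m.choose 2 - 2 * m + 2)] at card_mul
  exact Nat.eq_of_mul_eq_mul_right (Nat.two_pow_pos _) card_mul

theorem isCode_cssUnionCode_goethals (hm : m = 2 * k + 4) (hk : 1 ≤ k)
    (hF : Fintype.card F = 2 ^ (2 * k + 3)) {T₁ T₂ : Finset ((Fin m → ZMod 2) → ZMod 2)}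
    (hT₁ : IsCosetDecomposition (reedMuller (m - 3) m) (goethals e) T₁)
    (hT₂ : IsCosetDecomposition (reedMuller (m - 3) m) (goethals e) T₂) :
    IsCode (cssUnionCode (reedMuller (m - 3) m) (reedMuller (m - 3) m) T₁ T₂)
      (2 ^ m) (2 ^ (2 ^ m - 6 * m + 2)) 8 := by
  have hm5 : 5 ≤ m := by omega
  have self_orthogonal := dual_reedMuller_sub_three_le hm5
  have zero_mem := zero_mem_goethals e hm
  refine ⟨card_words m, ?_, ?_⟩
  · have choose_ge := two_mul_le_choose_two hm5
    have finrank_le := Submodule.finrank_mono self_orthogonal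
    have finrank_add := finrank_reedMuller_sub_three (m := m) (by omega)
    rw [finrank_dual_reedMuller_sub_three (by omega)] at finrank_le
    rw [finrank_cssUnionCode hT₁ hT₂, hT₁.card_goethals e hm hk hF, hT₂.card_goethals e hm hk hF,
      finrank_cssCode_reedMuller hm5, ← pow_add, ← pow_add]
    congr 1
    omega
  · obtain ⟨a, ha, ha', weight_eq⟩ := exists_mem_reedMuller_hammingNorm_eq_eight (m := m) (by omega)
    have dist_ge := pairwise_goethals_eight_le_hammingDist e hm hF
    rw [← weight_eq] at dist_ge ⊢
    exact hasMinDistance_cssUnionCode self_orthogonal hT₁ hT₂ zero_mem zero_mem ha ha' dist_ge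
      dist_ge

end Goethals

end Parameters

end QCode

end

theorem mainTheorem3 (m : ℕ) (hm : 6 ≤ m) (hme : Even m)
    (F : Type*) [Field F] [Fintype F] (hF : Fintype.card F = 2 ^ (m - 1))
    (e : (Fin m → ZMod 2) ≃+ F × ZMod 2) :
    -- the CSS code of `RM(m-3,m)`
    QCode.dual (QCode.reedMuller (m - 3) m) ≤ QCode.reedMuller (m - 3) m ∧
    QCode.IsStabilizerCode
      (QCode.cssCode (QCode.reedMuller (m - 3) m) (QCode.reedMuller (m - 3) m)) ∧
    QCode.IsCode (QCode.cssCode (QCode.reedMuller (m - 3) m) (QCode.reedMuller (m - 3) m))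
      (2 ^ m) (2 ^ (2 ^ m - 2 * m.choose 2 - 2 * m - 2)) 8 ∧
    -- the Goethals code as a union of cosets of `RM(m-3,m)`
    (∃ T, QCode.IsCosetDecomposition (QCode.reedMuller (m - 3) m) (QCode.goethals e) T) ∧
    (∀ T, QCode.IsCosetDecomposition (QCode.reedMuller (m - 3) m) (QCode.goethals e) T →
      T.card = 2 ^ (m.choose 2 - 2 * m + 2)) ∧
    -- the CSS-like union code
    ∀ T₁ T₂ : Finset ((Fin m → ZMod 2) → ZMod 2),
      QCode.IsCosetDecomposition (QCode.reedMuller (m - 3) m) (QCode.goethals e) T₁ →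
      QCode.IsCosetDecomposition (QCode.reedMuller (m - 3) m) (QCode.goethals e) T₂ →
      (∀ t ∈ T₁ ×ˢ T₂, ∀ t' ∈ T₁ ×ˢ T₂, t ≠ t' →
        QCode.translate (QCode.cssCode (QCode.reedMuller (m - 3) m) (QCode.reedMuller (m - 3) m)) t ⟂
          QCode.translate (QCode.cssCode (QCode.reedMuller (m - 3) m) (QCode.reedMuller (m - 3) m)) t') ∧
      QCode.IsCode
        (QCode.cssUnionCode (QCode.reedMuller (m - 3) m) (QCode.reedMuller (m - 3) m) T₁ T₂) (2 ^ m) (2 ^ (2 ^ m - 6 * m + 2)) 8 ∧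
      ¬ QCode.IsStabilizerCode
        (QCode.cssUnionCode (QCode.reedMuller (m - 3) m) (QCode.reedMuller (m - 3) m) T₁ T₂) ∧
      (m = 6 → QCode.IsCode
        (QCode.cssUnionCode (QCode.reedMuller (m - 3) m) (QCode.reedMuller (m - 3) m) T₁ T₂) 64 (2 ^ 30) 8) ∧
      (m = 8 → QCode.IsCode
        (QCode.cssUnionCode (QCode.reedMuller (m - 3) m) (QCode.reedMuller (m - 3) m) T₁ T₂) 256 (2 ^ 210) 8) := by
  obtain ⟨k, hmk, hk⟩ : ∃ k, m = 2 * k + 4 ∧ 1 ≤ k := by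
    obtain ⟨i, hi⟩ := hme
    exact ⟨i - 2, by omega, by omega⟩
  have hF' : Fintype.card F = 2 ^ (2 * k + 3) := by rw [hF, hmk, Nat.add_sub_assoc (by norm_num)]
  have : CharP F 2 := charP_of_card_eq_prime_pow hF
  let _ : Algebra (ZMod 2) F := ZMod.algebra F 2
  have self_orthogonal := QCode.dual_reedMuller_sub_three_le (m := m) (by omega)
  have zero_mem := QCode.zero_mem_goethals e hmk
  obtain ⟨g, hg, g', hg', hgg'⟩ := QCode.exists_add_notMem_goethals e hmk hk hF'
  refine ⟨self_orthogonal, QCode.isStabilizerCode_cssCode self_orthogonal,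
    QCode.isCode_cssCode_reedMuller hm,
    QCode.exists_isCosetDecomposition fun _ hc _ hg =>
      QCode.add_mem_goethals e hmk (by omega) hc hg,
    fun T hT => hT.card_goethals e hmk hk hF', fun T₁ T₂ hT₁ hT₂ => ?_⟩
  have union_isCode := QCode.isCode_cssUnionCode_goethals e hmk hk hF' hT₁ hT₂
  refine ⟨QCode.pairwise_isOrtho_translate_cssCode hT₁ hT₂, union_isCode,
    QCode.not_isStabilizerCode_cssUnionCode self_orthogonal hT₁ hT₂ zero_mem zero_mem hg hg' hgg',
    ?_, ?_⟩
  all_goals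
    rintro rfl
    exact union_isCode
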